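/- Let $k$ be a field of characteristic different from $2$, let $n\ge 3$, and let $\mathbb A^n=\operatorname{Spec} R$ with $R=k[r,s,t,y_1,\dots,y_{n-3}]$. Let $u:v$ and $u':v'$ be homogeneous coordinates on $\mathbb P^1\times\mathbb P^1$. Consider the following (étale) local models of the rank $9$ sheaf attached to an involution surface bundle. Here $r=0$ is the locus where the degree $2$ covering is ramified, $s=0$ and $t=0$ are two components of the ramification divisor, and all modules lie in $\operatorname{Frac}(R)[u,v,u',v']$: * $M_1$ is the $R[r^{-1},s^{-1}]$-module generated by $t^2u^2u'^2$, $tu^2u'v'$, $t^2u^2v'^2$, $tuvu'^2$, $uvu'v'$, $tuvv'^2$, $t^2v^2u'^2$, $tv^2u'v'$, $t^2v^2v'^2$; * $M_2$ is the $R[r^{-1},t^{-1}]$-module generated by $s^2(u^2+v^2)(u'^2+v'^2)$, $s(u^2+v^2)(u'^2-v'^2)$, $s^2(u^2+v^2)u'v'$, $s(u^2-v^2)(u'^2+v'^2)$, $(u^2-v^2)(u'^2-v'^2)$, $s(u^2-v^2)u'v'$, $s^2uv(u'^2+v'^2)$, $suv(u'^2-v'^2)$, $s^2uvu'v'$; *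 $M_3$ is the $R[s^{-1},t^{-1}]$-module generated by $r^2u^2u'^2$, $r^2(uv'+vu')^2$, $(uv'-vu')^2$, $r^2v^2v'^2$, $ruu'(uv'-vu')$, $rvv'(uv'-vu')$, $r(uv'+vu')(uv'-vu')$, $r^2uu'(uv'+vu')$, $r^2vv'(uv'+vu')$. Let $j\colon U\hookrightarrow\mathbb A^n$ be the inclusion of the union of the three charts $D(rs)$, $D(rt)$, $D(st)$, that is, of the complement of the pairwise intersections of the divisors $r=0$, $s=0$, $t=0$. (1) The intersection $M_1\cap M_2\cap M_3$ is the free $R$-module with basis $x_0=r^2s^2uvu'v'$, $x_1=r^2t^2(u^2-v^2)(u'^2-v'^2)$, $x_2=s^2t^2(uv'-vu')^2$, $x_3=rst(uu'+vv')(uv'-vu')$, $x_4=r^2st(uu'-vv')(uv'+vu')$, $x_5=rs^2t(uu'-vv')(uv'-vu')$, $x_6=rst^2(uv'+vu')(uv'-vu')$, $x_7=r^2s^2t(uu'+vv')(uv'+vu')$, $x_8=r^2st^2(uu'-vv')(uu'+vv')$, and $x_0,\dots,x_8$ is also a basis of each $M_i$ over the coordinate ring of its chart. (2) The sheaves $\widetilde{M_1}$,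 $\widetilde{M_2}$, $\widetilde{M_3}$ on the charts glue, inside the constant sheaf of forms, to a sheaf $F$ of $\mathcal O_U$-modules, and for every such $F$ the direct image $j_*F$ is the sheaf attached to $M_1\cap M_2\cap M_3$ (compatibly with the embeddings in the sheaf of forms); it is free of rank $9$, in particular locally free. (3) Let $X_U\subset\mathbb P^8\times U$ be the involution surface bundle over $U$ in the $\mathbb P^8$-bundle with homogeneous coordinates $X_0,\dots,X_8$ corresponding to $x_0,\dots,x_8$, namely the locus over $U$ where all homogeneous $G\in R[X_0,\dots,X_8]$ with $G(x_0,\dots,x_8)=0$ vanish (the closed image in $\mathbb P^8\times U$ of the $\mathbb P^1\times\mathbb P^1$-fibration over $rst\ne 0$ under $(x_0:\dots:x_8)$). Let $X$ be the Zariski closure of $X_U$ in $\mathbb P^8\times\mathbb A^n$, with its reduced scheme structure. Then the fiber of $X\to\mathbb A^n$ over every point of $\{r=s=t=0\}$ has dimension at least $3$, and $X\to\mathbb A^n$ is not flat. -/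

import Mathlib

open AlgebraicGeometry CategoryTheory

universe u

noncomputable section

namespace InvolutionSurface

/-! ### The base `𝔸ⁿ`, `n = m + 3`, and the ambient space of forms -/

/-- The coordinate ring `k[r, s, t, y₁, …, yₘ]` of affine space of dimension `m + 3 ≥ 3`. -/
abbrev BaseRing (k : Type u) [Field k] (m : ℕ) : Type u := MvPolynomial (Fin (m + 3)) k

/-- The function field of the base. -/
abbrev FunField (k : Type u) [Field k] (m : ℕ) : Type u := FractionRing (BaseRing k m)

/-- Polynomials in the two pairs of homogeneous coordinates `u, v` and `u', v'` of `ℙ¹ × ℙ¹`,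
over the function field of the base. -/
abbrev Forms (k : Type u) [Field k] (m : ℕ) : Type u := MvPolynomial (Fin 4) (FunField k m)

variable (k : Type u) [Field k] (m : ℕ)

/-- The coordinate `r` on the base; the degree `2` covering is ramified along `r = 0`. -/
def r : BaseRing k m := MvPolynomial.X 0

/-- The coordinate `s` on the base; `s = 0` is a component of the ramification divisor. -/
def s : BaseRing k m := MvPolynomial.X 1

/-- The coordinate `t` on the base; `t = 0` is a component of the ramification divisor. -/
def t : BaseRing k m := MvPolynomial.X 2

def u : Forms k m := MvPolynomial.X 0
def v : Forms k m := MvPolynomial.X 1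
def u' : Forms k m := MvPolynomial.X 2
def v' : Forms k m := MvPolynomial.X 3

/-! ### The three local models -/

/-- Generators of the local model along `t = 0`. -/
def genT : Fin 9 → Forms k m :=
  let u := u k m; let v := v k m; let u' := u' k m; let v' := v' k m; let t := t k m
  ![t ^ 2 • (u ^ 2 * u' ^ 2), t • (u ^ 2 * u' * v'), t ^ 2 • (u ^ 2 * v' ^ 2),
    t • (u * v * u' ^ 2), u * v * u' * v', t • (u * v * v' ^ 2),
    t ^ 2 • (v ^ 2 * u' ^ 2), t • (v ^ 2 * u' * v'), t ^ 2 • (v ^ 2 * v' ^ 2)]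

/-- Generators of the local model along `s = 0`. -/
def genS : Fin 9 → Forms k m :=
  let u := u k m; let v := v k m; let u' := u' k m; let v' := v' k m; let s := s k m
  ![s ^ 2 • ((u ^ 2 + v ^ 2) * (u' ^ 2 + v' ^ 2)), s • ((u ^ 2 + v ^ 2) * (u' ^ 2 - v' ^ 2)),
    s ^ 2 • ((u ^ 2 + v ^ 2) * (u' * v')),
    s • ((u ^ 2 - v ^ 2) * (u' ^ 2 + v' ^ 2)), (u ^ 2 - v ^ 2) * (u' ^ 2 - v' ^ 2),
    s • ((u ^ 2 - v ^ 2) * (u' * v')),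
    s ^ 2 • (u * v * (u' ^ 2 + v' ^ 2)), s • (u * v * (u' ^ 2 - v' ^ 2)),
    s ^ 2 • (u * v * (u' * v'))]

/-- Generators of the local model along `r = 0`. -/
def genR : Fin 9 → Forms k m :=
  let u := u k m; let v := v k m; let u' := u' k m; let v' := v' k m; let r := r k m
  ![r ^ 2 • (u ^ 2 * u' ^ 2), r ^ 2 • (u * v' + v * u') ^ 2, (u * v' - v * u') ^ 2,
    r ^ 2 • (v ^ 2 * v' ^ 2),
    r • (u * u' * (u * v' - v * u')), r • (v * v' * (u * v' - v * u')),
    r • ((u * v' + v * u') * (u * v' - v * u')),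
    r ^ 2 • (u * u' * (u * v' + v * u')), r ^ 2 • (v * v' * (u * v' + v * u'))]

/-- The generators of the three local models. -/
def localGen : Fin 3 → Fin 9 → Forms k m := ![genT k m, genS k m, genR k m]

/-- The function that is invertible on the chart of each local model: the charts are
`rs ≠ 0`, `rt ≠ 0` and `st ≠ 0`. -/
def chartFun : Fin 3 → BaseRing k m := ![r k m * s k m, r k m * t k m, s k m * t k m]

/-- The coordinate ring of a chart, i.e. `k[r, r⁻¹, s, s⁻¹, t, y]`, `k[r, r⁻¹, s, t, t⁻¹, y]` or
`k[r, s, s⁻¹, t, t⁻¹, y]`, as a subring of the function field. -/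
def chartRing (i : Fin 3) : Subalgebra (BaseRing k m) (FunField k m) :=
  Algebra.adjoin (BaseRing k m) {(algebraMap (BaseRing k m) (FunField k m) (chartFun k m i))⁻¹}

/-- The local model on a chart, as a module over the coordinate ring of the chart. -/
def localModel (i : Fin 3) : Submodule (chartRing k m i) (Forms k m) :=
  Submodule.span (chartRing k m i) (Set.range (localGen k m i))

/-- The local model on a chart, as a module over `k[r, s, t, y]`. -/
def localModelBase (i : Fin 3) : Submodule (BaseRing k m) (Forms k m) :=
  (localModel k m i).restrictScalars (BaseRing k m)

/-- The intersection of the three local models, as a module over `k[r, s, t, y]`. -/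
def interModule : Submodule (BaseRing k m) (Forms k m) := ⨅ i, localModelBase k m i

/-- The nine explicit forms `x₀, …, x₈`. -/
def extGen : Fin 9 → Forms k m :=
  let u := u k m; let v := v k m; let u' := u' k m; let v' := v' k m
  let r := r k m; let s := s k m; let t := t k m
  ![(r ^ 2 * s ^ 2) • (u * v * u' * v'),
    (r ^ 2 * t ^ 2) • ((u ^ 2 - v ^ 2) * (u' ^ 2 - v' ^ 2)),
    (s ^ 2 * t ^ 2) • (u * v' - v * u') ^ 2,
    (r * s * t) • ((u * u' + v * v') * (u * v' - v * u')),
    (r ^ 2 * s * t) • ((u * u' - v * v') * (u * v' + v * u')),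
    (r * s ^ 2 * t) • ((u * u' - v * v') * (u * v' - v * u')),
    (r * s * t ^ 2) • ((u * v' + v * u') * (u * v' - v * u')),
    (r ^ 2 * s ^ 2 * t) • ((u * u' + v * v') * (u * v' + v * u')),
    (r ^ 2 * s * t ^ 2) • ((u * u' - v * v') * (u * u' + v * v'))]

/-! ### The locally free sheaf of rank `9` and its direct image -/

/-- Affine space of dimension `m + 3`. -/
abbrev base : Scheme.{u} := Spec (.of (BaseRing k m))

/-- The open subset of the base over which a local model is defined. -/
def chart (i : Fin 3) : (base k m).Opens := PrimeSpectrum.basicOpen (chartFun k m i)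

/-- The union of the charts, i.e. the complement of the pairwise intersections of the divisors
`r = 0`, `s = 0`, `t = 0`. -/
def locus : (base k m).Opens := ⨆ i, chart k m i

lemma chart_le_locus (i : Fin 3) : chart k m i ≤ locus k m := le_iSup (chart k m) i

/-- The quasi-coherent sheaf on the base attached to a module of forms. -/
abbrev sheafOf (M : Submodule (BaseRing k m) (Forms k m)) : (base k m).Modules :=
  tilde (ModuleCat.of (BaseRing k m) M)

/-- The (constant) quasi-coherent sheaf on the base attached to the module of all forms. -/
abbrev sheafOfForms : (base k m).Modules := tilde (ModuleCat.of (BaseRing k m) (Forms k m))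

/-- The inclusion of the sheaf attached to a module of forms in the sheaf of all forms. -/
abbrev sheafIncl (M : Submodule (BaseRing k m) (Forms k m)) :
    sheafOf k m M ⟶ sheafOfForms k m :=
  tilde.map (ModuleCat.ofHom M.subtype)

/-- A sheaf `F` of modules on the union of the charts, together with data that exhibit it as the
sheaf glued, inside the sheaf of all forms, from the sheaves attached to the local models. -/
structure Gluing (F : (locus k m).toScheme.Modules) where
  /-- The embedding of `F` in the sheaf of all forms. -/
  incl : F ⟶ (sheafOfForms k m).restrict (locus k m).ι
  /-- On each chart `F` is the sheaf attached to the local model. -/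
  chartIso (i : Fin 3) :
    F.restrict ((base k m).homOfLE (chart_le_locus k m i)) ≅
      ((sheafOf k m (localModelBase k m i)).restrict (locus k m).ι).restrict
        ((base k m).homOfLE (chart_le_locus k m i))
  /-- The identification on each chart is compatible with the embeddings. -/
  compat (i : Fin 3) :
    (chartIso i).hom ≫
        (Scheme.Modules.restrictFunctor ((base k m).homOfLE (chart_le_locus k m i))).map
          ((Scheme.Modules.restrictFunctor (locus k m).ι).map
            (sheafIncl k m (localModelBase k m i))) =
      (Scheme.Modules.restrictFunctor ((base k m).homOfLE (chart_le_locus k m i))).map incl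

/-- The direct image under the inclusion of the union of the charts in the base. -/
abbrev directImage (F : (locus k m).toScheme.Modules) : (base k m).Modules :=
  (Scheme.Modules.pushforward (locus k m).ι).obj F

/-! ### The involution surface bundle and its Zariski closure -/

/-- The standard grading of `R[X₀, …, X₈]`. -/
abbrev grading (R : Type u) [CommRing R] : ℕ → Submodule R (MvPolynomial (Fin 9) R) :=
  MvPolynomial.homogeneousSubmodule (Fin 9) R

attribute [local instance] MvPolynomial.gradedAlgebra

/-- The projective space `ℙ⁸` over `Spec R`, as `Proj R[X₀, …, X₈]`. -/
abbrev projSpace (R : Type u) [CommRing R] : Scheme.{u} := Proj (grading R)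

/-- The structure morphism of `ℙ⁸` over `Spec R`. -/
def projSpaceMap (R : Type u) [CommRing R] : projSpace R ⟶ Spec (.of R) :=
  Proj.toSpecZero (grading R) ≫ Spec.map (CommRingCat.ofHom (algebraMap R (grading R 0)))

/-- The projective bundle `ℙ⁸` over the base, with homogeneous coordinates `X₀, …, X₈`
corresponding to the sections `x₀, …, x₈`. -/
abbrev ambient : Scheme.{u} := projSpace (BaseRing k m)

/-- The structure morphism of the projective bundle. -/
abbrev ambientMap : ambient k m ⟶ base k m := projSpaceMap (BaseRing k m)

/-- The involution surface bundle over the union of the charts, as a subset of the projective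
bundle: the points over the union of the charts at which all the homogeneous relations between the
sections `x₀, …, x₈` vanish. This is the embedding by the sections of the local
models: over each chart, `x₀, …, x₈` is a basis of the local model. -/
def surfaceBundle : Set (ambient k m) :=
  {p | ambientMap k m p ∈ locus k m ∧
    ∀ (d : ℕ), ∀ G ∈ grading (BaseRing k m) d, MvPolynomial.aeval (extGen k m) G = 0 →
      G ∈ p.asHomogeneousIdeal}

/-- The Zariski closure of the involution surface bundle in the projective bundle, with its
structure of reduced closed subscheme. -/
def closureScheme : Scheme.{u} :=
  (Scheme.IdealSheafData.vanishingIdeal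
    (TopologicalSpace.Closeds.closure (surfaceBundle k m))).subscheme

/-- The structure morphism of the Zariski closure. -/
def closureMap : closureScheme k m ⟶ base k m :=
  (Scheme.IdealSheafData.vanishingIdeal
    (TopologicalSpace.Closeds.closure (surfaceBundle k m))).subschemeι ≫ ambientMap k m

end InvolutionSurface

end

noncomputable section

set_option linter.unusedSimpArgs false
namespace InvolutionSurface

/-! The intersection. On each chart two of `r`, `s`, `t` are units, possibly together with `2`, and
explicit linear identities pass between the local generators and `x₀, …, x₈` (`localModel_eq_span`).
Up to powers of `t` the generators along `t = 0` are distinct monomials, so `x₀, …, x₈` are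
independent over the function field. A form in all three local models has coordinates in the
function field that are regular on every chart. The charts contain every prime of height one, since
`r`, `s`, `t` are pairwise non-associated primes, and the base ring is a UFD, so the coordinates are
regular: `interModule_eq_span`.

The sheaf. The module of all forms is torsion free and divisible, so sections of its sheaf over a
nonempty open set are constant. Every sheaf in play is a subsheaf of this one, or of its restriction
or direct image, and subsheaves with the same sections are isomorphic (`exists_iso_of_range_eq`).
Gluing and the computation of the direct image thereby become statements about which forms lie
locally in which module; the direct image is again the Hartogs argument.

The fibers. A relation among the `xᵢ` survives every specialization of the base coordinates and of
`u, v, u', v'`. Along suitable curves with parameter `e` that reach `r = s = t = 0` at `e = 0`, all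
nine `xᵢ` share a factor; cancelling it and putting `e = 0` leaves a point that depends on three
free parameters (`extForms_curve`, `eval₂_specialCoord_eq_zero`). The closure therefore contains a
three-dimensional family in each such fiber.

Non-flatness. Where `X₂ = 1`, the closure satisfies `r² + s² b + t² c = 0` for functions `b`, `c`.
If it were flat, the equational criterion would write `1` as a combination of first entries of
relations among `r², s², t²` over the base. Such entries vanish at the origin, so the fiber of this
chart over the origin would be empty; but it contains a special point (`not_flat_closureMap`). -/

theorem forall_fin_nine {p : Fin 9 → Prop} (h0 : p 0) (h1 : p 1) (h2 : p 2) (h3 : p 3) (h4 : p 4)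
    (h5 : p 5) (h6 : p 6) (h7 : p 7) (h8 : p 8) : ∀ i, p i := by
  intro i; fin_cases i <;> assumption

/-! ### Linear identities between the local generators and `x₀, …, x₈` -/

section GenericForms

variable {R A : Type*} [CommRing R] [CommRing A] [Algebra R A] (r s t : R) (u v u' v' : A)

/-- The generators of the local model along `t = 0`, for elements of arbitrary rings. -/
def formsT : Fin 9 → A :=
  ![t ^ 2 • (u ^ 2 * u' ^ 2), t • (u ^ 2 * u' * v'), t ^ 2 • (u ^ 2 * v' ^ 2),
    t • (u * v * u' ^ 2), u * v * u' * v', t • (u * v * v' ^ 2),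
    t ^ 2 • (v ^ 2 * u' ^ 2), t • (v ^ 2 * u' * v'), t ^ 2 • (v ^ 2 * v' ^ 2)]

/-- The generators of the local model along `s = 0`, for elements of arbitrary rings. -/
def formsS : Fin 9 → A :=
  ![s ^ 2 • ((u ^ 2 + v ^ 2) * (u' ^ 2 + v' ^ 2)), s • ((u ^ 2 + v ^ 2) * (u' ^ 2 - v' ^ 2)),
    s ^ 2 • ((u ^ 2 + v ^ 2) * (u' * v')),
    s • ((u ^ 2 - v ^ 2) * (u' ^ 2 + v' ^ 2)), (u ^ 2 - v ^ 2) * (u' ^ 2 - v' ^ 2),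
    s • ((u ^ 2 - v ^ 2) * (u' * v')),
    s ^ 2 • (u * v * (u' ^ 2 + v' ^ 2)), s • (u * v * (u' ^ 2 - v' ^ 2)),
    s ^ 2 • (u * v * (u' * v'))]

/-- The generators of the local model along `r = 0`, for elements of arbitrary rings. -/
def formsR : Fin 9 → A :=
  ![r ^ 2 • (u ^ 2 * u' ^ 2), r ^ 2 • (u * v' + v * u') ^ 2, (u * v' - v * u') ^ 2,
    r ^ 2 • (v ^ 2 * v' ^ 2),
    r • (u * u' * (u * v' - v * u')), r • (v * v' * (u * v' - v * u')),
    r • ((u * v' + v * u') * (u * v' - v * u')),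
    r ^ 2 • (u * u' * (u * v' + v * u')), r ^ 2 • (v * v' * (u * v' + v * u'))]

/-- The nine forms `x₀, …, x₈`, for elements of arbitrary rings. -/
def extForms : Fin 9 → A :=
  ![(r ^ 2 * s ^ 2) • (u * v * u' * v'),
    (r ^ 2 * t ^ 2) • ((u ^ 2 - v ^ 2) * (u' ^ 2 - v' ^ 2)),
    (s ^ 2 * t ^ 2) • (u * v' - v * u') ^ 2,
    (r * s * t) • ((u * u' + v * v') * (u * v' - v * u')),
    (r ^ 2 * s * t) • ((u * u' - v * v') * (u * v' + v * u')),
    (r * s ^ 2 * t) • ((u * u' - v * v') * (u * v' - v * u')),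
    (r * s * t ^ 2) • ((u * v' + v * u') * (u * v' - v * u')),
    (r ^ 2 * s ^ 2 * t) • ((u * u' + v * v') * (u * v' + v * u')),
    (r ^ 2 * s * t ^ 2) • ((u * u' - v * v') * (u * u' + v * v'))]

variable {r s t u v u' v'}

/-- Expanding the products gives monomials with coefficients in `R`, so nothing has to be cancelled.
The analogous statements for `formsS` and `formsR` need division by `2`. -/
theorem extForms_mem_of_formsT_mem {P : Submodule R A} (hP : ∀ l, formsT t u v u' v' l ∈ P) :
    ∀ j, extForms r s t u v u' v' j ∈ P := by
  refine forall_fin_nine ?_ ?_ ?_ ?_ ?_ ?_ ?_ ?_ ?_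
  · rw [show extForms r s t u v u' v' 0 = (r ^ 2 * s ^ 2) • formsT t u v u' v' 4 by
      simp only [extForms, formsT, Matrix.cons_val, Algebra.smul_def,
      map_mul, map_pow, map_neg, map_ofNat, map_one]]
    repeat first | exact P.smul_mem _ (hP _) | apply P.add_mem
  · rw [show extForms r s t u v u' v' 1 = (r ^ 2) • formsT t u v u' v' 0 +
        (-r ^ 2) • formsT t u v u' v' 2 + (-r ^ 2) • formsT t u v u' v' 6 +
        (r ^ 2) • formsT t u v u' v' 8 by
      simp only [extForms, formsT, Matrix.cons_val, Algebra.smul_def,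
      map_mul, map_pow, map_neg, map_ofNat, map_one]
      ring]
    repeat first | exact P.smul_mem _ (hP _) | apply P.add_mem
  · rw [show extForms r s t u v u' v' 2 = (s ^ 2) • formsT t u v u' v' 2 +
        ((-2) * s ^ 2 * t ^ 2) • formsT t u v u' v' 4 + (s ^ 2) • formsT t u v u' v' 6 by
      simp only [extForms, formsT, Matrix.cons_val, Algebra.smul_def,
      map_mul, map_pow, map_neg, map_ofNat, map_one]
      ring]
    repeat first | exact P.smul_mem _ (hP _) | apply P.add_mem
  · rw [show extForms r s t u v u' v' 3 = (r * s) • formsT t u v u' v' 1 +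
        (-r * s) • formsT t u v u' v' 3 + (r * s) • formsT t u v u' v' 5 +
        (-r * s) • formsT t u v u' v' 7 by
      simp only [extForms, formsT, Matrix.cons_val, Algebra.smul_def,
      map_mul, map_pow, map_neg, map_ofNat, map_one]
      ring]
    repeat first | exact P.smul_mem _ (hP _) | apply P.add_mem
  · rw [show extForms r s t u v u' v' 4 = (r ^ 2 * s) • formsT t u v u' v' 1 +
        (r ^ 2 * s) • formsT t u v u' v' 3 + (-r ^ 2 * s) • formsT t u v u' v' 5 +
        (-r ^ 2 * s) • formsT t u v u' v' 7 by
      simp only [extForms, formsT, Matrix.cons_val, Algebra.smul_def,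
      map_mul, map_pow, map_neg, map_ofNat, map_one]
      ring]
    repeat first | exact P.smul_mem _ (hP _) | apply P.add_mem
  · rw [show extForms r s t u v u' v' 5 = (r * s ^ 2) • formsT t u v u' v' 1 +
        (-r * s ^ 2) • formsT t u v u' v' 3 + (-r * s ^ 2) • formsT t u v u' v' 5 +
        (r * s ^ 2) • formsT t u v u' v' 7 by
      simp only [extForms, formsT, Matrix.cons_val, Algebra.smul_def,
      map_mul, map_pow, map_neg, map_ofNat, map_one]
      ring]
    repeat first | exact P.smul_mem _ (hP _) | apply P.add_mem
  · rw [show extForms r s t u v u' v' 6 = (r * s) • formsT t u v u' v' 2 +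
        (-r * s) • formsT t u v u' v' 6 by
      simp only [extForms, formsT, Matrix.cons_val, Algebra.smul_def,
      map_mul, map_pow, map_neg, map_ofNat, map_one]
      ring]
    repeat first | exact P.smul_mem _ (hP _) | apply P.add_mem
  · rw [show extForms r s t u v u' v' 7 = (r ^ 2 * s ^ 2) • formsT t u v u' v' 1 +
        (r ^ 2 * s ^ 2) • formsT t u v u' v' 3 + (r ^ 2 * s ^ 2) • formsT t u v u' v' 5 +
        (r ^ 2 * s ^ 2) • formsT t u v u' v' 7 by
      simp only [extForms, formsT, Matrix.cons_val, Algebra.smul_def,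
      map_mul, map_pow, map_neg, map_ofNat, map_one]
      ring]
    repeat first | exact P.smul_mem _ (hP _) | apply P.add_mem
  · rw [show extForms r s t u v u' v' 8 = (r ^ 2 * s) • formsT t u v u' v' 0 +
        (-r ^ 2 * s) • formsT t u v u' v' 8 by
      simp only [extForms, formsT, Matrix.cons_val, Algebra.smul_def,
      map_mul, map_pow, map_neg, map_ofNat, map_one]
      ring]
    repeat first | exact P.smul_mem _ (hP _) | apply P.add_mem

/-- The hypothesis `hD` lets elements of `D` be cancelled in `P`, as units could be. The inverse
change of basis is then written without denominators: sums and differences of the `xᵢ` isolate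
single monomials after multiplication by powers of `2`, `r`, `s`. -/
theorem formsT_mem_of_extForms_mem {P : Submodule R A} {D : Submonoid R}
    (hD : ∀ c ∈ D, ∀ x, c • x ∈ P → x ∈ P)
    (h2 : 2 ∈ D) (hr : r ∈ D) (hs : s ∈ D) (hP : ∀ l, extForms r s t u v u' v' l ∈ P) : ∀ j,
        formsT t u v u' v' j ∈ P := by
  refine forall_fin_nine ?_ ?_ ?_ ?_ ?_ ?_ ?_ ?_ ?_
  · refine hD (2 * r ^ 2 * s ^ 2) (by
      repeat first | assumption | with_reducible apply mul_mem | with_reducible apply pow_mem) _ ?_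
    rw [show (2 * r ^ 2 * s ^ 2) • formsT t u v u' v' 0 = (2 * t ^ 2) • extForms r s t u v u' v'
        0 + (s ^ 2) • extForms r s t u v u' v' 1 + (r ^ 2) • extForms r s t u v u' v' 2 +
        (s) • extForms r s t u v u' v' 8 by
      simp only [extForms, formsT, Matrix.cons_val, Algebra.smul_def,
      map_mul, map_pow, map_neg, map_ofNat, map_one]
      ring]
    repeat first | exact P.smul_mem _ (hP _) | apply P.add_mem
  · refine hD (2 * 2 * r ^ 2 * s ^ 2) (by
      repeat first | assumption | with_reducible apply mul_mem | with_reducible apply pow_mem) _ ?_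
    rw [show (2 * 2 * r ^ 2 * s ^ 2) • formsT t u v u' v' 1 = (r * s) • extForms r s t u v u' v'
        3 + (s) • extForms r s t u v u' v' 4 + (r) • extForms r s t u v u' v' 5 +
        (1 : R) • extForms r s t u v u' v' 7 by
      simp only [extForms, formsT, Matrix.cons_val, Algebra.smul_def,
      map_mul, map_pow, map_neg, map_ofNat, map_one]
      ring]
    repeat first | exact P.smul_mem _ (hP _) | apply P.add_mem
  · refine hD (2 * r ^ 2 * s ^ 2) (by
      repeat first | assumption | with_reducible apply mul_mem | with_reducible apply pow_mem) _ ?_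
    rw [show (2 * r ^ 2 * s ^ 2) • formsT t u v u' v' 2 = (2 * t ^ 2) • extForms r s t u v u' v'
        0 + (r ^ 2) • extForms r s t u v u' v' 2 + (r * s) • extForms r s t u v u' v' 6 by
      simp only [extForms, formsT, Matrix.cons_val, Algebra.smul_def,
      map_mul, map_pow, map_neg, map_ofNat, map_one]
      ring]
    repeat first | exact P.smul_mem _ (hP _) | apply P.add_mem
  · refine hD (2 * 2 * r ^ 2 * s ^ 2) (by
      repeat first | assumption | with_reducible apply mul_mem | with_reducible apply pow_mem) _ ?_
    rw [show (2 * 2 * r ^ 2 * s ^ 2) • formsT t u v u' v' 3 = (-r * s) • extForms r s t u v u' v'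
        3 + (s) • extForms r s t u v u' v' 4 + (-r) • extForms r s t u v u' v' 5 +
        (1 : R) • extForms r s t u v u' v' 7 by
      simp only [extForms, formsT, Matrix.cons_val, Algebra.smul_def,
      map_mul, map_pow, map_neg, map_ofNat, map_one]
      ring]
    repeat first | exact P.smul_mem _ (hP _) | apply P.add_mem
  · refine hD (r ^ 2 * s ^ 2) (by
      repeat first | assumption | with_reducible apply mul_mem | with_reducible apply pow_mem) _ ?_
    rw [show (r ^ 2 * s ^ 2) • formsT t u v u' v' 4 = (1 : R) • extForms r s t u v u' v' 0 by
      simp only [extForms, formsT, Matrix.cons_val, Algebra.smul_def,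
      map_mul, map_pow, map_neg, map_ofNat, map_one]
      ring]
    repeat first | exact P.smul_mem _ (hP _) | apply P.add_mem
  · refine hD (2 * 2 * r ^ 2 * s ^ 2) (by
      repeat first | assumption | with_reducible apply mul_mem | with_reducible apply pow_mem) _ ?_
    rw [show (2 * 2 * r ^ 2 * s ^ 2) • formsT t u v u' v' 5 = (r * s) • extForms r s t u v u' v'
        3 + (-s) • extForms r s t u v u' v' 4 + (-r) • extForms r s t u v u' v' 5 +
        (1 : R) • extForms r s t u v u' v' 7 by
      simp only [extForms, formsT, Matrix.cons_val, Algebra.smul_def,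
      map_mul, map_pow, map_neg, map_ofNat, map_one]
      ring]
    repeat first | exact P.smul_mem _ (hP _) | apply P.add_mem
  · refine hD (2 * r ^ 2 * s ^ 2) (by
      repeat first | assumption | with_reducible apply mul_mem | with_reducible apply pow_mem) _ ?_
    rw [show (2 * r ^ 2 * s ^ 2) • formsT t u v u' v' 6 = (2 * t ^ 2) • extForms r s t u v u' v'
        0 + (r ^ 2) • extForms r s t u v u' v' 2 + (-r * s) • extForms r s t u v u' v' 6 by
      simp only [extForms, formsT, Matrix.cons_val, Algebra.smul_def,
      map_mul, map_pow, map_neg, map_ofNat, map_one]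
      ring]
    repeat first | exact P.smul_mem _ (hP _) | apply P.add_mem
  · refine hD (2 * 2 * r ^ 2 * s ^ 2) (by
      repeat first | assumption | with_reducible apply mul_mem | with_reducible apply pow_mem) _ ?_
    rw [show (2 * 2 * r ^ 2 * s ^ 2) • formsT t u v u' v' 7 = (-r * s) • extForms r s t u v u' v'
        3 + (-s) • extForms r s t u v u' v' 4 + (r) • extForms r s t u v u' v' 5 +
        (1 : R) • extForms r s t u v u' v' 7 by
      simp only [extForms, formsT, Matrix.cons_val, Algebra.smul_def,
      map_mul, map_pow, map_neg, map_ofNat, map_one]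
      ring]
    repeat first | exact P.smul_mem _ (hP _) | apply P.add_mem
  · refine hD (2 * r ^ 2 * s ^ 2) (by
      repeat first | assumption | with_reducible apply mul_mem | with_reducible apply pow_mem) _ ?_
    rw [show (2 * r ^ 2 * s ^ 2) • formsT t u v u' v' 8 = (2 * t ^ 2) • extForms r s t u v u' v'
        0 + (s ^ 2) • extForms r s t u v u' v' 1 + (r ^ 2) • extForms r s t u v u' v' 2 +
        (-s) • extForms r s t u v u' v' 8 by
      simp only [extForms, formsT, Matrix.cons_val, Algebra.smul_def,
      map_mul, map_pow, map_neg, map_ofNat, map_one]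
      ring]
    repeat first | exact P.smul_mem _ (hP _) | apply P.add_mem

theorem extForms_mem_of_formsS_mem {P : Submodule R A} {D : Submonoid R}
    (hD : ∀ c ∈ D, ∀ x, c • x ∈ P → x ∈ P)
    (h2 : 2 ∈ D) (hP : ∀ l, formsS s u v u' v' l ∈ P) : ∀ j, extForms r s t u v u' v' j ∈ P := by
  refine forall_fin_nine ?_ ?_ ?_ ?_ ?_ ?_ ?_ ?_ ?_
  · rw [show extForms r s t u v u' v' 0 = (r ^ 2) • formsS s u v u' v' 8 by
      simp only [extForms, formsS, Matrix.cons_val, Algebra.smul_def,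
      map_mul, map_pow, map_neg, map_ofNat, map_one]
      ring]
    repeat first | exact P.smul_mem _ (hP _) | apply P.add_mem
  · rw [show extForms r s t u v u' v' 1 = (r ^ 2 * t ^ 2) • formsS s u v u' v' 4 by
      simp only [extForms, formsS, Matrix.cons_val, Algebra.smul_def,
      map_mul, map_pow, map_neg, map_ofNat, map_one]]
    repeat first | exact P.smul_mem _ (hP _) | apply P.add_mem
  · refine hD (2) (by
      repeat first | assumption | with_reducible apply mul_mem | with_reducible apply pow_mem) _ ?_
    rw [show (2 : R) • extForms r s t u v u' v' 2 = (t ^ 2) • formsS s u v u' v' 0 +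
        (-s ^ 2 * t ^ 2) • formsS s u v u' v' 4 + ((-4) * t ^ 2) • formsS s u v u' v' 8 by
      simp only [extForms, formsS, Matrix.cons_val, Algebra.smul_def,
      map_mul, map_pow, map_neg, map_ofNat, map_one]
      ring]
    repeat first | exact P.smul_mem _ (hP _) | apply P.add_mem
  · rw [show extForms r s t u v u' v' 3 = (r * t) • formsS s u v u' v' 5 +
        (-r * t) • formsS s u v u' v' 7 by
      simp only [extForms, formsS, Matrix.cons_val, Algebra.smul_def,
      map_mul, map_pow, map_neg, map_ofNat, map_one]
      ring]
    repeat first | exact P.smul_mem _ (hP _) | apply P.add_mem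
  · rw [show extForms r s t u v u' v' 4 = (r ^ 2 * t) • formsS s u v u' v' 5 +
        (r ^ 2 * t) • formsS s u v u' v' 7 by
      simp only [extForms, formsS, Matrix.cons_val, Algebra.smul_def,
      map_mul, map_pow, map_neg, map_ofNat, map_one]
      ring]
    repeat first | exact P.smul_mem _ (hP _) | apply P.add_mem
  · rw [show extForms r s t u v u' v' 5 = (r * t) • formsS s u v u' v' 2 +
        (-r * t) • formsS s u v u' v' 6 by
      simp only [extForms, formsS, Matrix.cons_val, Algebra.smul_def,
      map_mul, map_pow, map_neg, map_ofNat, map_one]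
      ring]
    repeat first | exact P.smul_mem _ (hP _) | apply P.add_mem
  · refine hD (2) (by
      repeat first | assumption | with_reducible apply mul_mem | with_reducible apply pow_mem) _ ?_
    rw [show (2 : R) • extForms r s t u v u' v' 6 = (-r * t ^ 2) • formsS s u v u' v' 1 +
        (r * t ^ 2) • formsS s u v u' v' 3 by
      simp only [extForms, formsS, Matrix.cons_val, Algebra.smul_def,
      map_mul, map_pow, map_neg, map_ofNat, map_one]
      ring]
    repeat first | exact P.smul_mem _ (hP _) | apply P.add_mem
  · rw [show extForms r s t u v u' v' 7 = (r ^ 2 * t) • formsS s u v u' v' 2 +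
        (r ^ 2 * t) • formsS s u v u' v' 6 by
      simp only [extForms, formsS, Matrix.cons_val, Algebra.smul_def,
      map_mul, map_pow, map_neg, map_ofNat, map_one]
      ring]
    repeat first | exact P.smul_mem _ (hP _) | apply P.add_mem
  · refine hD (2) (by
      repeat first | assumption | with_reducible apply mul_mem | with_reducible apply pow_mem) _ ?_
    rw [show (2 : R) • extForms r s t u v u' v' 8 = (r ^ 2 * t ^ 2) • formsS s u v u' v' 1 +
        (r ^ 2 * t ^ 2) • formsS s u v u' v' 3 by
      simp only [extForms, formsS, Matrix.cons_val, Algebra.smul_def,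
      map_mul, map_pow, map_neg, map_ofNat, map_one]
      ring]
    repeat first | exact P.smul_mem _ (hP _) | apply P.add_mem

theorem formsS_mem_of_extForms_mem {P : Submodule R A} {D : Submonoid R}
    (hD : ∀ c ∈ D, ∀ x, c • x ∈ P → x ∈ P)
    (h2 : 2 ∈ D) (hr : r ∈ D) (ht : t ∈ D) (hP : ∀ l, extForms r s t u v u' v' l ∈ P) : ∀ j,
        formsS s u v u' v' j ∈ P := by
  refine forall_fin_nine ?_ ?_ ?_ ?_ ?_ ?_ ?_ ?_ ?_
  · refine hD (r ^ 2 * t ^ 2) (by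
      repeat first | assumption | with_reducible apply mul_mem | with_reducible apply pow_mem) _ ?_
    rw [show (r ^ 2 * t ^ 2) • formsS s u v u' v' 0 = (4 * t ^ 2) • extForms r s t u v u' v' 0 +
        (s ^ 2) • extForms r s t u v u' v' 1 + (2 * r ^ 2) • extForms r s t u v u' v' 2 by
      simp only [extForms, formsS, Matrix.cons_val, Algebra.smul_def,
      map_mul, map_pow, map_neg, map_ofNat, map_one]
      ring]
    repeat first | exact P.smul_mem _ (hP _) | apply P.add_mem
  · refine hD (r ^ 2 * t ^ 2) (by
      repeat first | assumption | with_reducible apply mul_mem | with_reducible apply pow_mem) _ ?_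
    rw [show (r ^ 2 * t ^ 2) • formsS s u v u' v' 1 = (-r) • extForms r s t u v u' v' 6 +
        (1 : R) • extForms r s t u v u' v' 8 by
      simp only [extForms, formsS, Matrix.cons_val, Algebra.smul_def,
      map_mul, map_pow, map_neg, map_ofNat, map_one]
      ring]
    repeat first | exact P.smul_mem _ (hP _) | apply P.add_mem
  · refine hD (2 * r ^ 2 * t) (by
      repeat first | assumption | with_reducible apply mul_mem | with_reducible apply pow_mem) _ ?_
    rw [show (2 * r ^ 2 * t) • formsS s u v u' v' 2 = (r) • extForms r s t u v u' v' 5 +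
        (1 : R) • extForms r s t u v u' v' 7 by
      simp only [extForms, formsS, Matrix.cons_val, Algebra.smul_def,
      map_mul, map_pow, map_neg, map_ofNat, map_one]
      ring]
    repeat first | exact P.smul_mem _ (hP _) | apply P.add_mem
  · refine hD (r ^ 2 * t ^ 2) (by
      repeat first | assumption | with_reducible apply mul_mem | with_reducible apply pow_mem) _ ?_
    rw [show (r ^ 2 * t ^ 2) • formsS s u v u' v' 3 = (r) • extForms r s t u v u' v' 6 +
        (1 : R) • extForms r s t u v u' v' 8 by
      simp only [extForms, formsS, Matrix.cons_val, Algebra.smul_def,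
      map_mul, map_pow, map_neg, map_ofNat, map_one]
      ring]
    repeat first | exact P.smul_mem _ (hP _) | apply P.add_mem
  · refine hD (r ^ 2 * t ^ 2) (by
      repeat first | assumption | with_reducible apply mul_mem | with_reducible apply pow_mem) _ ?_
    rw [show (r ^ 2 * t ^ 2) • formsS s u v u' v' 4 = (1 : R) • extForms r s t u v u' v' 1 by
      simp only [extForms, formsS, Matrix.cons_val, Algebra.smul_def,
      map_mul, map_pow, map_neg, map_ofNat, map_one]
      ring]
    repeat first | exact P.smul_mem _ (hP _) | apply P.add_mem
  · refine hD (2 * r ^ 2 * t) (by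
      repeat first | assumption | with_reducible apply mul_mem | with_reducible apply pow_mem) _ ?_
    rw [show (2 * r ^ 2 * t) • formsS s u v u' v' 5 = (r) • extForms r s t u v u' v' 3 +
        (1 : R) • extForms r s t u v u' v' 4 by
      simp only [extForms, formsS, Matrix.cons_val, Algebra.smul_def,
      map_mul, map_pow, map_neg, map_ofNat, map_one]
      ring]
    repeat first | exact P.smul_mem _ (hP _) | apply P.add_mem
  · refine hD (2 * r ^ 2 * t) (by
      repeat first | assumption | with_reducible apply mul_mem | with_reducible apply pow_mem) _ ?_
    rw [show (2 * r ^ 2 * t) • formsS s u v u' v' 6 = (-r) • extForms r s t u v u' v' 5 +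
        (1 : R) • extForms r s t u v u' v' 7 by
      simp only [extForms, formsS, Matrix.cons_val, Algebra.smul_def,
      map_mul, map_pow, map_neg, map_ofNat, map_one]
      ring]
    repeat first | exact P.smul_mem _ (hP _) | apply P.add_mem
  · refine hD (2 * r ^ 2 * t) (by
      repeat first | assumption | with_reducible apply mul_mem | with_reducible apply pow_mem) _ ?_
    rw [show (2 * r ^ 2 * t) • formsS s u v u' v' 7 = (-r) • extForms r s t u v u' v' 3 +
        (1 : R) • extForms r s t u v u' v' 4 by
      simp only [extForms, formsS, Matrix.cons_val, Algebra.smul_def,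
      map_mul, map_pow, map_neg, map_ofNat, map_one]
      ring]
    repeat first | exact P.smul_mem _ (hP _) | apply P.add_mem
  · refine hD (r ^ 2) (by
      repeat first | assumption | with_reducible apply mul_mem | with_reducible apply pow_mem) _ ?_
    rw [show (r ^ 2) • formsS s u v u' v' 8 = (1 : R) • extForms r s t u v u' v' 0 by
      simp only [extForms, formsS, Matrix.cons_val, Algebra.smul_def,
      map_mul, map_pow, map_neg, map_ofNat, map_one]
      ring]
    repeat first | exact P.smul_mem _ (hP _) | apply P.add_mem

theorem extForms_mem_of_formsR_mem {P : Submodule R A} {D : Submonoid R}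
    (hD : ∀ c ∈ D, ∀ x, c • x ∈ P → x ∈ P)
    (h2 : 2 ∈ D) (hP : ∀ l, formsR r u v u' v' l ∈ P) : ∀ j, extForms r s t u v u' v' j ∈ P := by
  refine forall_fin_nine ?_ ?_ ?_ ?_ ?_ ?_ ?_ ?_ ?_
  · refine hD (2 * 2) (by
      repeat first | assumption | with_reducible apply mul_mem | with_reducible apply pow_mem) _ ?_
    rw [show (2 * 2 : R) • extForms r s t u v u' v' 0 = (s ^ 2) • formsR r u v u' v' 1 +
        (-r ^ 2 * s ^ 2) • formsR r u v u' v' 2 by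
      simp only [extForms, formsR, Matrix.cons_val, Algebra.smul_def,
      map_mul, map_pow, map_neg, map_ofNat, map_one]
      ring]
    repeat first | exact P.smul_mem _ (hP _) | apply P.add_mem
  · refine hD (2) (by
      repeat first | assumption | with_reducible apply mul_mem | with_reducible apply pow_mem) _ ?_
    rw [show (2 : R) • extForms r s t u v u' v' 1 = (2 * t ^ 2) • formsR r u v u' v' 0 +
        (-t ^ 2) • formsR r u v u' v' 1 + (-r ^ 2 * t ^ 2) • formsR r u v u' v' 2 +
        (2 * t ^ 2) • formsR r u v u' v' 3 by
      simp only [extForms, formsR, Matrix.cons_val, Algebra.smul_def,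
      map_mul, map_pow, map_neg, map_ofNat, map_one]
      ring]
    repeat first | exact P.smul_mem _ (hP _) | apply P.add_mem
  · rw [show extForms r s t u v u' v' 2 = (s ^ 2 * t ^ 2) • formsR r u v u' v' 2 by
      simp only [extForms, formsR, Matrix.cons_val, Algebra.smul_def,
      map_mul, map_pow, map_neg, map_ofNat, map_one]]
    repeat first | exact P.smul_mem _ (hP _) | apply P.add_mem
  · rw [show extForms r s t u v u' v' 3 = (s * t) • formsR r u v u' v' 4 +
        (s * t) • formsR r u v u' v' 5 by
      simp only [extForms, formsR, Matrix.cons_val, Algebra.smul_def,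
      map_mul, map_pow, map_neg, map_ofNat, map_one]
      ring]
    repeat first | exact P.smul_mem _ (hP _) | apply P.add_mem
  · rw [show extForms r s t u v u' v' 4 = (s * t) • formsR r u v u' v' 7 +
        (-s * t) • formsR r u v u' v' 8 by
      simp only [extForms, formsR, Matrix.cons_val, Algebra.smul_def,
      map_mul, map_pow, map_neg, map_ofNat, map_one]
      ring]
    repeat first | exact P.smul_mem _ (hP _) | apply P.add_mem
  · rw [show extForms r s t u v u' v' 5 = (s ^ 2 * t) • formsR r u v u' v' 4 +
        (-s ^ 2 * t) • formsR r u v u' v' 5 by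
      simp only [extForms, formsR, Matrix.cons_val, Algebra.smul_def,
      map_mul, map_pow, map_neg, map_ofNat, map_one]
      ring]
    repeat first | exact P.smul_mem _ (hP _) | apply P.add_mem
  · rw [show extForms r s t u v u' v' 6 = (s * t ^ 2) • formsR r u v u' v' 6 by
      simp only [extForms, formsR, Matrix.cons_val, Algebra.smul_def,
      map_mul, map_pow, map_neg, map_ofNat, map_one]
      ring]
    repeat first | exact P.smul_mem _ (hP _) | apply P.add_mem
  · rw [show extForms r s t u v u' v' 7 = (s ^ 2 * t) • formsR r u v u' v' 7 +
        (s ^ 2 * t) • formsR r u v u' v' 8 by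
      simp only [extForms, formsR, Matrix.cons_val, Algebra.smul_def,
      map_mul, map_pow, map_neg, map_ofNat, map_one]
      ring]
    repeat first | exact P.smul_mem _ (hP _) | apply P.add_mem
  · rw [show extForms r s t u v u' v' 8 = (s * t ^ 2) • formsR r u v u' v' 0 +
        (-s * t ^ 2) • formsR r u v u' v' 3 by
      simp only [extForms, formsR, Matrix.cons_val, Algebra.smul_def,
      map_mul, map_pow, map_neg, map_ofNat, map_one]
      ring]
    repeat first | exact P.smul_mem _ (hP _) | apply P.add_mem

theorem formsR_mem_of_extForms_mem {P : Submodule R A} {D : Submonoid R}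
    (hD : ∀ c ∈ D, ∀ x, c • x ∈ P → x ∈ P)
    (h2 : 2 ∈ D) (hs : s ∈ D) (ht : t ∈ D) (hP : ∀ l, extForms r s t u v u' v' l ∈ P) : ∀ j,
        formsR r u v u' v' j ∈ P := by
  refine forall_fin_nine ?_ ?_ ?_ ?_ ?_ ?_ ?_ ?_ ?_
  · refine hD (2 * s ^ 2 * t ^ 2) (by
      repeat first | assumption | with_reducible apply mul_mem | with_reducible apply pow_mem) _ ?_
    rw [show (2 * s ^ 2 * t ^ 2) • formsR r u v u' v' 0 = (2 * t ^ 2) • extForms r s t u v u' v'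
        0 + (s ^ 2) • extForms r s t u v u' v' 1 + (r ^ 2) • extForms r s t u v u' v' 2 +
        (s) • extForms r s t u v u' v' 8 by
      simp only [extForms, formsR, Matrix.cons_val, Algebra.smul_def,
      map_mul, map_pow, map_neg, map_ofNat, map_one]
      ring]
    repeat first | exact P.smul_mem _ (hP _) | apply P.add_mem
  · refine hD (s ^ 2 * t ^ 2) (by
      repeat first | assumption | with_reducible apply mul_mem | with_reducible apply pow_mem) _ ?_
    rw [show (s ^ 2 * t ^ 2) • formsR r u v u' v' 1 = (4 * t ^ 2) • extForms r s t u v u' v' 0 +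
        (r ^ 2) • extForms r s t u v u' v' 2 by
      simp only [extForms, formsR, Matrix.cons_val, Algebra.smul_def,
      map_mul, map_pow, map_neg, map_ofNat, map_one]
      ring]
    repeat first | exact P.smul_mem _ (hP _) | apply P.add_mem
  · refine hD (s ^ 2 * t ^ 2) (by
      repeat first | assumption | with_reducible apply mul_mem | with_reducible apply pow_mem) _ ?_
    rw [show (s ^ 2 * t ^ 2) • formsR r u v u' v' 2 = (1 : R) • extForms r s t u v u' v' 2 by
      simp only [extForms, formsR, Matrix.cons_val, Algebra.smul_def,
      map_mul, map_pow, map_neg, map_ofNat, map_one]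
      ring]
    repeat first | exact P.smul_mem _ (hP _) | apply P.add_mem
  · refine hD (2 * s ^ 2 * t ^ 2) (by
      repeat first | assumption | with_reducible apply mul_mem | with_reducible apply pow_mem) _ ?_
    rw [show (2 * s ^ 2 * t ^ 2) • formsR r u v u' v' 3 = (2 * t ^ 2) • extForms r s t u v u' v'
        0 + (s ^ 2) • extForms r s t u v u' v' 1 + (r ^ 2) • extForms r s t u v u' v' 2 +
        (-s) • extForms r s t u v u' v' 8 by
      simp only [extForms, formsR, Matrix.cons_val, Algebra.smul_def,
      map_mul, map_pow, map_neg, map_ofNat, map_one]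
      ring]
    repeat first | exact P.smul_mem _ (hP _) | apply P.add_mem
  · refine hD (2 * s ^ 2 * t) (by
      repeat first | assumption | with_reducible apply mul_mem | with_reducible apply pow_mem) _ ?_
    rw [show (2 * s ^ 2 * t) • formsR r u v u' v' 4 = (s) • extForms r s t u v u' v' 3 +
        (1 : R) • extForms r s t u v u' v' 5 by
      simp only [extForms, formsR, Matrix.cons_val, Algebra.smul_def,
      map_mul, map_pow, map_neg, map_ofNat, map_one]
      ring]
    repeat first | exact P.smul_mem _ (hP _) | apply P.add_mem
  · refine hD (2 * s ^ 2 * t) (by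
      repeat first | assumption | with_reducible apply mul_mem | with_reducible apply pow_mem) _ ?_
    rw [show (2 * s ^ 2 * t) • formsR r u v u' v' 5 = (s) • extForms r s t u v u' v' 3 +
        (-1 : R) • extForms r s t u v u' v' 5 by
      simp only [extForms, formsR, Matrix.cons_val, Algebra.smul_def,
      map_mul, map_pow, map_neg, map_ofNat, map_one]
      ring]
    repeat first | exact P.smul_mem _ (hP _) | apply P.add_mem
  · refine hD (s * t ^ 2) (by
      repeat first | assumption | with_reducible apply mul_mem | with_reducible apply pow_mem) _ ?_
    rw [show (s * t ^ 2) • formsR r u v u' v' 6 = (1 : R) • extForms r s t u v u' v' 6 by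
      simp only [extForms, formsR, Matrix.cons_val, Algebra.smul_def,
      map_mul, map_pow, map_neg, map_ofNat, map_one]
      ring]
    repeat first | exact P.smul_mem _ (hP _) | apply P.add_mem
  · refine hD (2 * s ^ 2 * t) (by
      repeat first | assumption | with_reducible apply mul_mem | with_reducible apply pow_mem) _ ?_
    rw [show (2 * s ^ 2 * t) • formsR r u v u' v' 7 = (s) • extForms r s t u v u' v' 4 +
        (1 : R) • extForms r s t u v u' v' 7 by
      simp only [extForms, formsR, Matrix.cons_val, Algebra.smul_def,
      map_mul, map_pow, map_neg, map_ofNat, map_one]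
      ring]
    repeat first | exact P.smul_mem _ (hP _) | apply P.add_mem
  · refine hD (2 * s ^ 2 * t) (by
      repeat first | assumption | with_reducible apply mul_mem | with_reducible apply pow_mem) _ ?_
    rw [show (2 * s ^ 2 * t) • formsR r u v u' v' 8 = (-s) • extForms r s t u v u' v' 4 +
        (1 : R) • extForms r s t u v u' v' 7 by
      simp only [extForms, formsR, Matrix.cons_val, Algebra.smul_def,
      map_mul, map_pow, map_neg, map_ofNat, map_one]
      ring]
    repeat first | exact P.smul_mem _ (hP _) | apply P.add_mem

end GenericForms

section LocalModels

variable (k : Type u) [Field k] (m : ℕ)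

theorem extGen_eq : extGen k m =
    extForms (r k m) (s k m) (t k m) (u k m) (v k m) (u' k m) (v' k m) := rfl

end LocalModels

end InvolutionSurface

/-! ### Bases of the local models -/

namespace InvolutionSurface

variable {k : Type u} [Field k] {m : ℕ}

theorem r_ne_zero : r k m ≠ 0 := MvPolynomial.X_ne_zero _
theorem s_ne_zero : s k m ≠ 0 := MvPolynomial.X_ne_zero _
theorem t_ne_zero : t k m ≠ 0 := MvPolynomial.X_ne_zero _

theorem chartFun_ne_zero (i : Fin 3) : chartFun k m i ≠ 0 := by
  fin_cases i
  · exact mul_ne_zero r_ne_zero s_ne_zero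
  · exact mul_ne_zero r_ne_zero t_ne_zero
  · exact mul_ne_zero s_ne_zero t_ne_zero

theorem isUnit_chartFun (i : Fin 3) :
    IsUnit (algebraMap (BaseRing k m) (chartRing k m i) (chartFun k m i)) := by
  have h : algebraMap (BaseRing k m) (FunField k m) (chartFun k m i) ≠ 0 :=
    (FaithfulSMul.algebraMap_eq_zero_iff _ _).not.mpr (chartFun_ne_zero i)
  refine IsUnit.of_mul_eq_one ⟨_, Algebra.subset_adjoin rfl⟩ (Subtype.ext ?_)
  exact mul_inv_cancel₀ h

theorem isUnit_two (hk : (2 : k) ≠ 0) {B : Type*} [CommRing B] [Algebra (BaseRing k m) B] :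
    IsUnit (algebraMap (BaseRing k m) B 2) := by
  have : (2 : BaseRing k m) = MvPolynomial.C 2 := (map_ofNat MvPolynomial.C 2).symm
  rw [this]
  exact ((IsUnit.mk0 _ hk).map MvPolynomial.C).map _

theorem mem_localModelBase_of_smul_mem (i : Fin 3) {c : BaseRing k m}
    (hc : IsUnit (algebraMap (BaseRing k m) (chartRing k m i) c))
    {P : Submodule (chartRing k m i) (Forms k m)} (x : Forms k m) (h : c • x ∈ P) : x ∈ P := by
  obtain ⟨d, hd⟩ := hc.exists_left_inv
  have := P.smul_mem d h
  rwa [← algebraMap_smul (chartRing k m i) c x, smul_smul, hd, one_smul] at this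

/-- The elements of the base that become invertible on a chart. -/
def chartUnits (k : Type u) [Field k] (m : ℕ) (i : Fin 3) : Submonoid (BaseRing k m) :=
  (IsUnit.submonoid _).comap (algebraMap (BaseRing k m) (chartRing k m i))

/-- Both spans are modules over the chart ring, hence saturated with respect to `chartUnits`, which
contains `2` and the two coordinates inverted on the chart. The identities for `formsT`, `formsS`,
`formsR` apply in both directions. -/
theorem localModel_eq_span (hk : (2 : k) ≠ 0) (i : Fin 3) :
    localModel k m i = Submodule.span (chartRing k m i) (Set.range (extGen k m)) := by
  have h2 : (2 : BaseRing k m) ∈ chartUnits k m i := isUnit_two hk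
  have hu := isUnit_chartFun (k := k) (m := m) i
  have hD (P : Submodule (chartRing k m i) (Forms k m)) : ∀ c ∈ chartUnits k m i,
      ∀ x, c • x ∈ P.restrictScalars (BaseRing k m) → x ∈ P.restrictScalars (BaseRing k m) :=
    fun c hc x h ↦ mem_localModelBase_of_smul_mem i hc x h
  have hg (f : Fin 9 → Forms k m) (l : Fin 9) : f l ∈ (Submodule.span (chartRing k m i)
      (Set.range f)).restrictScalars (BaseRing k m) := Submodule.subset_span ⟨l, rfl⟩
  apply le_antisymm <;> rw [localModel, Submodule.span_le] <;> rintro _ ⟨j, rfl⟩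
  · fin_cases i
    · exact formsT_mem_of_extForms_mem (hD _) h2 (isUnit_of_mul_isUnit_left (by
        rwa [← map_mul])) (isUnit_of_mul_isUnit_right (by rwa [← map_mul])) (hg _) j
    · exact formsS_mem_of_extForms_mem (hD _) h2 (isUnit_of_mul_isUnit_left (by
        rwa [← map_mul])) (isUnit_of_mul_isUnit_right (by rwa [← map_mul])) (hg _) j
    · exact formsR_mem_of_extForms_mem (hD _) h2 (isUnit_of_mul_isUnit_left (by
        rwa [← map_mul])) (isUnit_of_mul_isUnit_right (by rwa [← map_mul])) (hg _) j
  · fin_cases i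
    · exact extForms_mem_of_formsT_mem (hg _) j
    · exact extForms_mem_of_formsS_mem (hD _) h2 (hg _) j
    · exact extForms_mem_of_formsR_mem (hD _) h2 (hg _) j

theorem linearIndependent_genT : LinearIndependent (FunField k m) (genT k m) := by
  have ht : algebraMap (BaseRing k m) (FunField k m) (t k m) ≠ 0 :=
    (FaithfulSMul.algebraMap_eq_zero_iff _ _).not.mpr t_ne_zero
  -- Each generator is a power of `t`, recorded in `c`, times the monomial with exponent vector `e`.
  let c : Fin 9 → (FunField k m)ˣ := ![.mk0 _ ht ^ 2, .mk0 _ ht, .mk0 _ ht ^ 2, .mk0 _ ht, 1,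
    .mk0 _ ht, .mk0 _ ht ^ 2, .mk0 _ ht, .mk0 _ ht ^ 2]
  let e : Fin 9 → Fin 4 →₀ ℕ := fun l ↦ Finsupp.equivFunOnFinite.symm
    ((![![2, 0, 2, 0], ![2, 0, 1, 1], ![2, 0, 0, 2], ![1, 1, 2, 0], ![1, 1, 1, 1], ![1, 1, 0, 2],
      ![0, 2, 2, 0], ![0, 2, 1, 1], ![0, 2, 0, 2]] : Fin 9 → Fin 4 → ℕ) l)
  have he : Function.Injective e := Finsupp.equivFunOnFinite.symm.injective.comp (by decide)
  have hm (f : Fin 4 → ℕ) : MvPolynomial.basisMonomials (Fin 4) (FunField k m)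
      (Finsupp.equivFunOnFinite.symm f) = 
        u k m ^ f 0 * v k m ^ f 1 * u' k m ^ f 2 * v' k m ^ f 3 := by
    simp [MvPolynomial.monomial_eq, Finsupp.prod_fintype, Fin.prod_univ_four, u, v, u', v']
  suffices h : genT k m = c • (MvPolynomial.basisMonomials (Fin 4) (FunField k m)) ∘ e by
    rw [h]
    exact ((MvPolynomial.basisMonomials (Fin 4) (FunField k m)).linearIndependent.comp e
      he).units_smul c
  funext l
  simp only [Pi.smul_apply', Function.comp_apply, e, hm]
  revert l
  refine forall_fin_nine ?_ ?_ ?_ ?_ ?_ ?_ ?_ ?_ ?_ <;>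
    simp [genT, c, Units.smul_def, ← IsScalarTower.algebraMap_smul (FunField k m) (t k m),
      Algebra.smul_def]

/-- A rank count: over the function field the span of these nine forms contains the nine independent
forms `genT`, so it has dimension at least nine. -/
theorem linearIndependent_extGen (hk : (2 : k) ≠ 0) :
    LinearIndependent (FunField k m) (extGen k m) := by
  rw [linearIndependent_iff_card_le_finrank_span]
  have hT := linearIndependent_iff_card_eq_finrank_span.mp (linearIndependent_genT (k := k) (m := m))
  rw [hT]
  have := FiniteDimensional.span_of_finite (FunField k m) (Set.finite_range (extGen k m))
  refine Submodule.finrank_mono (Submodule.span_le.mpr ?_)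
  rintro _ ⟨j, rfl⟩
  have h0 {c : BaseRing k m} (hc : c ≠ 0) : c ∈ nonZeroDivisors (BaseRing k m) :=
    mem_nonZeroDivisors_of_ne_zero hc
  have hg (l : Fin 9) : extGen k m l ∈ (Submodule.span (FunField k m)
      (Set.range (extGen k m))).restrictScalars (BaseRing k m) := Submodule.subset_span ⟨l, rfl⟩
  refine formsT_mem_of_extForms_mem (P := (Submodule.span (FunField k m)
    (Set.range (extGen k m))).restrictScalars (BaseRing k m)) (D := nonZeroDivisors _)
    (fun c hc x hx ↦ ?_) (h0 ?_) (h0 r_ne_zero) (h0 s_ne_zero)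
    hg j
  · have hu : algebraMap (BaseRing k m) (FunField k m) c ≠ 0 :=
      IsFractionRing.to_map_ne_zero_of_mem_nonZeroDivisors hc
    have hx' : algebraMap (BaseRing k m) (FunField k m) c • x ∈ Submodule.span (FunField k m)
        (Set.range (extGen k m)) := by rwa [algebraMap_smul]
    have h := (Submodule.smul_mem_iff _ hu).mp hx'
    exact h
  · intro h
    exact hk (MvPolynomial.C_injective (Fin (m + 3)) k (by rw [map_ofNat, h, map_zero]))

end InvolutionSurface

/-! ### Hartogs extension and the intersection of the local models -/

namespace InvolutionSurface

section Hartogs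

variable {R K : Type*} [CommRing R] [IsDomain R] [Field K] [Algebra R K] [IsFractionRing R K]

/-- A fraction over a unique factorization domain that is regular at all height one primes below a
prime ideal is regular at that prime ideal. -/
theorem exists_notMem_smul_eq_algebraMap [UniqueFactorizationMonoid R] (c : K) (p : Ideal R)
    [p.IsPrime] (h : ∀ π ∈ p, Prime π → ∃ d ∉ Ideal.span {π}, ∃ a, d • c = algebraMap R K a) :
    ∃ d ∉ p, ∃ a, d • c = algebraMap R K a := by
  -- In lowest terms `a / b`, the denominator `b` itself avoids `p`. Otherwise some prime factor `π`
  -- of `b` lies in `p`; regularity at `π` gives `d * a = b * e` with `π ∤ d`, so `π` divides `a` as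
  -- well as `b`.
  obtain ⟨a, b, hab, rfl⟩ := IsFractionRing.exists_reduced_fraction (A := R) c
  refine ⟨b, fun hb ↦ ?_, a, ?_⟩
  · have hb0 : (b : R) ≠ 0 := nonZeroDivisors.coe_ne_zero b
    obtain ⟨f, hf, u, hu⟩ := UniqueFactorizationMonoid.exists_prime_factors (b : R) hb0
    have : f.prod ∈ p := by
      rw [← hu] at hb
      exact (Ideal.IsPrime.mem_or_mem ‹_› hb).resolve_right fun h ↦
        Ideal.IsPrime.ne_top ‹_› (Ideal.eq_top_of_isUnit_mem _ h u.isUnit)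
    obtain ⟨π, hπf, hπ⟩ := (Ideal.IsPrime.multiset_prod_mem_iff_exists_mem ‹_› _).mp this
    obtain ⟨d, hd, e, he⟩ := h π hπ (hf π hπf)
    have hπb : π ∣ b := (Multiset.dvd_prod hπf).trans ⟨u, hu.symm⟩
    have h1 : d * a = b * e := by
      apply IsFractionRing.injective R K
      rw [map_mul, map_mul, ← he, Algebra.smul_def, mul_left_comm, IsLocalization.mk'_spec'_mk]
    have h2 : π ∣ d * a := h1 ▸ hπb.mul_right e
    rw [Ideal.mem_span_singleton] at hd
    exact (hf π hπf).not_isUnit (hab (((hf π hπf).dvd_or_dvd h2).resolve_left hd) hπb)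
  · rw [Algebra.smul_def, IsLocalization.mk'_spec']

end Hartogs

variable {k : Type u} [Field k] {m : ℕ}

/-- A prime dividing all of `rs`, `rt`, `st` divides two of the coordinates, which are
non-associated primes. This is the codimension two condition: every height one prime lies in a
chart. -/
theorem exists_chartFun_notMem_span {π : BaseRing k m} (hπ : Prime π) :
    ∃ i, chartFun k m i ∉ Ideal.span {π} := by
  by_contra! h
  simp only [Ideal.mem_span_singleton] at h
  have hX (i j : Fin (m + 3)) (hi : π ∣ MvPolynomial.X i) (hj : π ∣ MvPolynomial.X j) : i = j := by
    have h1 := (hπ.irreducible.associated_of_dvd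
      (MvPolynomial.X_prime (R := k)).irreducible hi).symm.dvd.trans hj
    exact MvPolynomial.X_dvd_X.mp h1
  have h01 : (0 : Fin (m + 3)) ≠ 1 := by simp
  have h02 : (0 : Fin (m + 3)) ≠ 2 := by
    simp [Fin.ext_iff, Nat.mod_eq_of_lt (show 2 < m + 3 by omega)]
  have h12 : (1 : Fin (m + 3)) ≠ 2 := by
    simp [Fin.ext_iff, Nat.mod_eq_of_lt (show 2 < m + 3 by omega)]
  rcases hπ.dvd_or_dvd (h 0) with h0 | h0
  · rcases hπ.dvd_or_dvd (h 2) with h1 | h1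
    · exact h01 (hX _ _ h0 h1)
    · exact h02 (hX _ _ h0 h1)
  · rcases hπ.dvd_or_dvd (h 1) with h1 | h1
    · exact h01 (hX _ _ h1 h0)
    · exact h12 (hX _ _ h0 h1)

/-- A rational function that is regular at all points of a locus closed under generization
outside the pairwise intersections of the divisors `r = 0`, `s = 0`, `t = 0` is regular. -/
theorem regular_of_regular_on_charts (c : FunField k m) (p : Ideal (BaseRing k m)) [p.IsPrime]
    (h : ∀ q : Ideal (BaseRing k m), q.IsPrime → q ≤ p → (∃ i, chartFun k m i ∉ q) →
      ∃ d ∉ q, ∃ a, d • c = algebraMap (BaseRing k m) (FunField k m) a) :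
    ∃ d ∉ p, ∃ a, d • c = algebraMap (BaseRing k m) (FunField k m) a :=
  exists_notMem_smul_eq_algebraMap c p fun _ hπp hπ ↦ h _
    ((Ideal.span_singleton_prime hπ.ne_zero).mpr hπ) ((Ideal.span_singleton_le_iff_mem _).mpr hπp)
    (exists_chartFun_notMem_span hπ)

theorem exists_pow_smul_of_mem_chartRing {i : Fin 3} {c : FunField k m} (hc : c ∈ chartRing k m i) :
    ∃ n : ℕ, ∃ a, chartFun k m i ^ n • c = algebraMap (BaseRing k m) (FunField k m) a := by
  have h0 : algebraMap (BaseRing k m) (FunField k m) (chartFun k m i) ≠ 0 :=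
    (FaithfulSMul.algebraMap_eq_zero_iff _ _).not.mpr (chartFun_ne_zero i)
  induction hc using Algebra.adjoin_induction with
  | mem x hx =>
    rw [Set.mem_singleton_iff] at hx
    exact ⟨1, 1, by rw [hx, Algebra.smul_def, pow_one, mul_inv_cancel₀ h0, map_one]⟩
  | algebraMap a => exact ⟨0, a, by simp⟩
  | add x y _ _ hx hy =>
    obtain ⟨n, a, ha⟩ := hx
    obtain ⟨l, b, hb⟩ := hy
    refine ⟨n + l, chartFun k m i ^ l * a + chartFun k m i ^ n * b, ?_⟩
    rw [smul_add, pow_add, map_add, map_mul, map_mul, ← ha, ← hb]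
    simp only [Algebra.smul_def, map_mul, map_pow]
    ring
  | mul x y _ _ hx hy =>
    obtain ⟨n, a, ha⟩ := hx
    obtain ⟨l, b, hb⟩ := hy
    refine ⟨n + l, a * b, ?_⟩
    rw [map_mul, ← ha, ← hb]
    simp only [Algebra.smul_def, map_mul, map_pow, pow_add]
    ring

theorem linearIndependent_extGen_base (hk : (2 : k) ≠ 0) :
    LinearIndependent (BaseRing k m) (extGen k m) :=
  (linearIndependent_extGen hk).restrict_scalars' _

theorem linearIndependent_extGen_chart (hk : (2 : k) ≠ 0) (i : Fin 3) :
    LinearIndependent (chartRing k m i) (extGen k m) :=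
  (linearIndependent_extGen hk).restrict_scalars' _

/-- A form lies in the span of `x₀, …, x₈` over the base, locally at a prime ideal `p`, as soon as
it does so at the primes below `p` that lie in one of the charts. -/
theorem exists_smul_mem_span_extGen (hk : (2 : k) ≠ 0) (x : Forms k m) (p : Ideal (BaseRing k m))
    [hp : p.IsPrime] (h : ∀ q : Ideal (BaseRing k m), q.IsPrime → q ≤ p →
      (∃ i, chartFun k m i ∉ q) →
      ∃ d ∉ q, d • x ∈ Submodule.span (BaseRing k m) (Set.range (extGen k m))) :
    ∃ d ∉ p, d • x ∈ Submodule.span (BaseRing k m) (Set.range (extGen k m)) := by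
  -- The hypothesis at the generic point `⊥`, which lies in every chart, provides coordinates of `x`
  -- over the function field.
  have hx : x ∈ Submodule.span (FunField k m) (Set.range (extGen k m)) := by
    obtain ⟨d, hd, hdx⟩ := h ⊥ inferInstance bot_le ⟨0, by simpa using chartFun_ne_zero 0⟩
    have h1 : d • x ∈ Submodule.span (FunField k m) (Set.range (extGen k m)) :=
      Submodule.span_le_restrictScalars (BaseRing k m) _ _ hdx
    rw [← algebraMap_smul (FunField k m) d x] at h1
    refine (Submodule.smul_mem_iff _ ?_).mp h1
    exact (FaithfulSMul.algebraMap_eq_zero_iff _ _).not.mpr hd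
  obtain ⟨c, rfl⟩ := (Submodule.mem_span_range_iff_exists_fun _).mp hx
  have hc (j : Fin 9) : ∃ d ∉ p, ∃ a, d • c j = algebraMap (BaseRing k m) (FunField k m) a := by
    refine regular_of_regular_on_charts (c j) p fun q hq hqp hqi ↦ ?_
    obtain ⟨d, hd, hdx⟩ := h q hq hqp hqi
    obtain ⟨a, ha⟩ := (Submodule.mem_span_range_iff_exists_fun _).mp hdx
    refine ⟨d, hd, a j, ?_⟩
    -- Coordinates are unique, so a membership `d • x` in the span over the base says that every `d
    -- • c j` is regular.
    have := linearIndependent_iff'ₛ.mp (linearIndependent_extGen (m := m) hk) Finset.univ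
      (fun j ↦ algebraMap (BaseRing k m) (FunField k m) (a j)) (fun j ↦ d • c j)
      (by simpa [Finset.smul_sum, smul_assoc] using ha) j (Finset.mem_univ j)
    exact this.symm
  choose d hd a ha using hc
  refine ⟨∏ j, d j, fun h ↦ ?_, ?_⟩
  · obtain ⟨j, -, hj⟩ := hp.prod_mem_iff.mp h
    exact hd j hj
  · rw [Finset.smul_sum]
    refine Submodule.sum_mem _ fun j _ ↦ ?_
    rw [← Finset.prod_erase_mul _ _ (Finset.mem_univ j), mul_smul, ← smul_assoc (d j), ha,
      algebraMap_smul]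
    exact Submodule.smul_mem _ _ (Submodule.smul_mem _ _ (Submodule.subset_span ⟨j, rfl⟩))

theorem exists_pow_smul_mem_span_of_mem_localModelBase (hk : (2 : k) ≠ 0) {i : Fin 3}
    {x : Forms k m} (hx : x ∈ localModelBase k m i) : ∃ n : ℕ,
    chartFun k m i ^ n • x ∈ Submodule.span (BaseRing k m) (Set.range (extGen k m)) := by
  rw [localModelBase, localModel_eq_span hk] at hx
  refine Submodule.span_induction ?_ ?_ ?_ ?_ (p := fun x _ ↦ ∃ n : ℕ,
    chartFun k m i ^ n • x ∈ Submodule.span (BaseRing k m) (Set.range (extGen k m))) hx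
  · exact fun x hx ↦ ⟨0, Submodule.smul_mem _ _ (Submodule.subset_span hx)⟩
  · exact ⟨0, by simp⟩
  · rintro x y _ _ ⟨n, hn⟩ ⟨l, hl⟩
    refine ⟨n + l, ?_⟩
    rw [smul_add]
    refine add_mem ?_ ?_
    · rw [add_comm n l, pow_add, mul_smul]; exact Submodule.smul_mem _ _ hn
    · rw [pow_add, mul_smul]; exact Submodule.smul_mem _ _ hl
  · rintro c x _ ⟨n, hn⟩
    obtain ⟨l, a, ha⟩ := exists_pow_smul_of_mem_chartRing c.2
    refine ⟨l + n, ?_⟩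
    have : chartFun k m i ^ (l + n) • c • x = a • chartFun k m i ^ n • x := by
      rw [pow_add, Subalgebra.smul_def, mul_comm, mul_smul, ← smul_assoc (chartFun k m i ^ l), ha,
        algebraMap_smul, smul_comm]
    rw [this]
    exact Submodule.smul_mem _ _ hn

theorem span_extGen_le_localModelBase (hk : (2 : k) ≠ 0) (i : Fin 3) :
    Submodule.span (BaseRing k m) (Set.range (extGen k m)) ≤ localModelBase k m i := by
  rw [localModelBase, localModel_eq_span hk]
  exact Submodule.span_le_restrictScalars _ _ _

/-- The multipliers carrying `x` into the span form an ideal `I`. By the local Hartogs statement no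
maximal ideal contains `I`, so `1 ∈ I`. -/
theorem interModule_eq_span (hk : (2 : k) ≠ 0) : interModule k m =
    Submodule.span (BaseRing k m) (Set.range (extGen k m)) := by
  refine le_antisymm (fun x hx ↦ ?_) (le_iInf (span_extGen_le_localModelBase hk))
  rw [interModule, Submodule.mem_iInf] at hx
  let N := Submodule.span (BaseRing k m) (Set.range (extGen k m))
  let I : Ideal (BaseRing k m) := N.comap (LinearMap.toSpanSingleton (BaseRing k m) _ x)
  have hI : I = ⊤ := by
    by_contra hI
    obtain ⟨p, hp, hIp⟩ := Ideal.exists_le_maximal I hI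
    obtain ⟨d, hd, hdx⟩ := exists_smul_mem_span_extGen hk x p fun q hq _ ⟨i, hi⟩ ↦ by
      obtain ⟨n, hn⟩ := exists_pow_smul_mem_span_of_mem_localModelBase hk (hx i)
      exact ⟨_, fun h ↦ hi (hq.mem_of_pow_mem n h), hn⟩
    exact hd (hIp hdx)
  have h1 : (1 : BaseRing k m) ∈ I := hI ▸ Submodule.mem_top
  simpa [I] using h1

end InvolutionSurface

/-! ### Sections of the sheaf attached to a module, through their germs -/

namespace InvolutionSurface

section Tilde

open Opposite TopologicalSpace

variable {R : CommRingCat.{u}} {M N : ModuleCat.{u} R} {U V : (Spec R).Opens}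

instance isPrime_asIdeal (x : Spec R) : (PrimeSpectrum.asIdeal x).IsPrime := PrimeSpectrum.isPrime x

/-- The value of a section of `M^~` in the localization of `M` at a point. -/
def germAt (σ : Γ(tilde M, U)) (x : U) : LocalizedModule x.1.asIdeal.primeCompl M :=
  (show (structureSheafInType R M).obj.obj (op U) from σ).1 x

theorem germAt_ext {σ τ : Γ(tilde M, U)} (h : ∀ x, germAt σ x = germAt τ x) : σ = τ :=
  Subtype.ext (funext h)

theorem germAt_res (i : V ⟶ U) (σ : Γ(tilde M, U)) (x : V) :
    germAt ((tilde M).presheaf.map i.op σ) x = germAt σ (i x) := rfl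

theorem germAt_map (f : M ⟶ N) (σ : Γ(tilde M, U)) (x : U) :
    germAt ((tilde.map f).app U σ) x =
      IsLocalizedModule.map x.1.asIdeal.primeCompl
        (LocalizedModule.mkLinearMap x.1.asIdeal.primeCompl M)
        (LocalizedModule.mkLinearMap x.1.asIdeal.primeCompl N) f.hom (germAt σ x) := rfl

theorem exists_germAt_eq_mk (σ : Γ(tilde M, U)) (x : U) : ∃ V : (Spec R).Opens, ∃ hV : V ≤ U,
    x.1 ∈ V ∧ ∃ (a : M) (d : R), ∀ y : V, ∃ hd : d ∉ y.1.asIdeal,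
      germAt σ ⟨y.1, hV y.2⟩ = LocalizedModule.mk a ⟨d, hd⟩ := by
  obtain ⟨V, hx, i, a, d, h⟩ := (show (structureSheafInType R M).obj.obj (op U) from σ).2 x
  exact ⟨V, i.le, hx, a, d, h⟩

theorem exists_germAt_eq (f : ∀ x : U, LocalizedModule x.1.asIdeal.primeCompl M)
    (hf : ∀ x : U, ∃ V : (Spec R).Opens, ∃ hV : V ≤ U,
      x.1 ∈ V ∧ ∃ (a : M) (d : R), ∀ y : V, ∃ hd : d ∉ y.1.asIdeal,
        f ⟨y.1, hV y.2⟩ = LocalizedModule.mk a ⟨d, hd⟩) :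
    ∃ σ : Γ(tilde M, U), ∀ x, germAt σ x = f x := by
  refine ⟨(⟨f, fun x ↦ ?_⟩ : (structureSheafInType R M).obj.obj (op U)), fun x ↦ rfl⟩
  obtain ⟨V, hV, hx, a, d, h⟩ := hf x
  exact ⟨V, hx, homOfLE hV, a, d, h⟩

theorem map_app_injective {f : M ⟶ N} (hf : Function.Injective f.hom) :
    Function.Injective ((tilde.map f).app U) := by
  intro σ τ h
  refine germAt_ext fun x ↦ ?_
  have h1 : germAt ((tilde.map f).app U σ) x = germAt ((tilde.map f).app U τ) x := by rw [h]
  rw [germAt_map, germAt_map] at h1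
  exact IsLocalizedModule.map_injective _ _ _ _ hf h1

/-- The condition involves each stalk separately. It suffices because the equality of fractions that
witnesses it at a point holds on a neighborhood, and injectivity of the localized maps makes the
chosen preimages in the stalks compatible. -/
theorem mem_range_map_app_iff {f : M ⟶ N} (hf : Function.Injective f.hom) (σ : Γ(tilde N, U)) :
    σ ∈ Set.range ((tilde.map f).app U) ↔
      ∀ x : U, ∃ (a : M) (d : R) (hd : d ∉ x.1.asIdeal),
        germAt σ x = LocalizedModule.mk (f.hom a) ⟨d, hd⟩ := by
  have hmap (x : U) (a : M) (d : R) (hd : d ∉ x.1.asIdeal) :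
      IsLocalizedModule.map x.1.asIdeal.primeCompl
        (LocalizedModule.mkLinearMap x.1.asIdeal.primeCompl M)
        (LocalizedModule.mkLinearMap x.1.asIdeal.primeCompl N) f.hom
        (LocalizedModule.mk a ⟨d, hd⟩) = LocalizedModule.mk (f.hom a) ⟨d, hd⟩ := by
    rw [IsLocalizedModule.mk_eq_mk', IsLocalizedModule.map_mk', IsLocalizedModule.mk_eq_mk']
  constructor
  · rintro ⟨τ, rfl⟩ x
    obtain ⟨V, hV, hx, a, d, h⟩ := exists_germAt_eq_mk τ x
    obtain ⟨hd, h1⟩ := h ⟨x.1, hx⟩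
    exact ⟨a, d, hd, by rw [germAt_map, h1, hmap]⟩
  · intro h
    choose a d hd h using h
    obtain ⟨τ, hτ⟩ := exists_germAt_eq (M := M) (U := U)
      (fun x ↦ LocalizedModule.mk (a x) ⟨d x, hd x⟩) fun x ↦ by
      obtain ⟨V, hV, hxV, b, c, hbc⟩ := exists_germAt_eq_mk σ x
      obtain ⟨hc, hbcx⟩ := hbc ⟨x.1, hxV⟩
      rw [h x, LocalizedModule.mk_eq] at hbcx
      obtain ⟨⟨e, he⟩, hx⟩ := hbcx
      -- Here `d x` is the denominator of the fraction at `x`, and `e` is the multiplier that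
      -- witnesses its equality with the local expression of `σ`; both must stay invertible.
      refine ⟨V ⊓ PrimeSpectrum.basicOpen (d x * e), inf_le_left.trans hV, ⟨hxV, ?_⟩, a x, d x,
        fun y ↦ ?_⟩
      · exact x.1.asIdeal.primeCompl.mul_mem (hd x) he
      · have hy : d x * e ∉ y.1.asIdeal := y.2.2
        have hdy : d x ∉ y.1.asIdeal := fun h ↦ hy (Ideal.mul_mem_right _ _ h)
        have hey : e ∉ y.1.asIdeal := fun h ↦ hy (Ideal.mul_mem_left _ _ h)
        refine ⟨hdy, IsLocalizedModule.map_injective y.1.asIdeal.primeCompl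
          (LocalizedModule.mkLinearMap y.1.asIdeal.primeCompl M)
          (LocalizedModule.mkLinearMap y.1.asIdeal.primeCompl N) f.hom hf ?_⟩
        let y' : U := ⟨y.1, hV y.2.1⟩
        obtain ⟨hcy, hbcy⟩ := hbc ⟨y.1, y.2.1⟩
        refine (hmap y' _ _ _).trans (Eq.trans ?_ (hmap y' _ _ _).symm)
        rw [← h y', hbcy, LocalizedModule.mk_eq]
        exact ⟨⟨e, hey⟩, hx.symm⟩
    refine ⟨τ, germAt_ext fun x ↦ ?_⟩
    rw [germAt_map, hτ, hmap, h]

end Tilde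

/-! ### The constant sheaf of a divisible torsion free module -/

section ConstantSheaf

open Opposite TopologicalSpace


variable {R : Type u} [CommRing R] [IsDomain R] {W : Type u} [AddCommGroup W] [Module R W]
  {U : (Spec (.of R)).Opens}

instance isPrime_asIdeal_spec_of (x : Spec (.of R)) :
    (PrimeSpectrum.asIdeal (R := R) x).IsPrime := PrimeSpectrum.isPrime x

theorem mk_eq_mk_iff_of_isTorsionFree [Module.IsTorsionFree R W] (p : Ideal R) [p.IsPrime]
    (v w : W) (d e : p.primeCompl) :
    LocalizedModule.mk v d = LocalizedModule.mk w e ↔ e.1 • v = d.1 • w := by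
  rw [LocalizedModule.mk_eq]
  constructor
  · rintro ⟨c, hc⟩
    have h0 : c.1 ≠ 0 := fun h ↦ c.2 (h ▸ p.zero_mem)
    exact smul_right_injective W h0 hc
  · exact fun h ↦ ⟨1, by rw [one_smul, one_smul]; exact h⟩

/-- The sections of the quasi-coherent sheaf attached to a divisible torsion free module over a
domain are constant. -/
theorem exists_germAt_eq_const [Module.IsTorsionFree R W]
    (hdiv : ∀ d : R, d ≠ 0 → ∀ w : W, ∃ w', d • w' = w) (hU : ∃ x : PrimeSpectrum R, x ∈ U)
    (σ : Γ(tilde (ModuleCat.of R W), U)) :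
    ∃ w : W, ∀ x : U, germAt σ x = LocalizedModule.mk w 1 := by
  have key (x : U) : ∃ V : (Spec (.of R)).Opens, ∃ hV : V ≤ U, x.1 ∈ V ∧
      ∃ w : W, ∀ y : V, germAt σ ⟨y.1, hV y.2⟩ = LocalizedModule.mk w 1 := by
    obtain ⟨V, hV, hx, a, d, h⟩ := exists_germAt_eq_mk σ x
    have hd0 : d ≠ 0 := fun hd0 ↦ (h ⟨x.1, hx⟩).1 (hd0 ▸ Ideal.zero_mem _)
    obtain ⟨w, hw⟩ := hdiv d hd0 a
    refine ⟨V, hV, hx, w, fun y ↦ ?_⟩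
    obtain ⟨hd, hy⟩ := h y
    rw [hy]
    exact (mk_eq_mk_iff_of_isTorsionFree _ _ _ _ _).mpr (by rw [← hw, OneMemClass.coe_one, one_smul])
  obtain ⟨x₀, hx₀⟩ := hU
  obtain ⟨V, hV, hx, w, h⟩ := key ⟨x₀, hx₀⟩
  refine ⟨w, fun x ↦ ?_⟩
  obtain ⟨V', hV', hx', w', h'⟩ := key x
  -- Any two nonempty open sets share the generic point, where the local constants can be compared.
  have hη (V : (Spec (.of R)).Opens) (x) (hx : x ∈ V) : (⊥ : PrimeSpectrum R) ∈ V :=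
    V.2.stableUnderGeneralization ((PrimeSpectrum.le_iff_specializes _ _).mp bot_le) hx
  have h1 := h ⟨(⊥ : PrimeSpectrum R), hη V _ hx⟩
  have h2 := h' ⟨(⊥ : PrimeSpectrum R), hη V' _ hx'⟩
  have h3 := (mk_eq_mk_iff_of_isTorsionFree _ _ _ _ _).mp (h1.symm.trans h2)
  rw [OneMemClass.coe_one, one_smul, one_smul] at h3
  rw [h3]
  exact h' ⟨x.1, hx'⟩

/-- This criterion turns questions on subsheaves of the constant sheaf into local membership of a
single element `w` in `M`. -/
theorem mem_range_map_subtype_app_iff [Module.IsTorsionFree R W] (M : Submodule R W)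
    (σ : Γ(tilde (ModuleCat.of R W), U)) (w : W)
    (hσ : ∀ x : U, germAt σ x = LocalizedModule.mk w 1) :
    σ ∈ Set.range ((tilde.map (R := .of R) (ModuleCat.ofHom M.subtype)).app U) ↔
      ∀ x : PrimeSpectrum R, x ∈ U → ∃ d ∉ x.asIdeal, d • w ∈ M := by
  rw [mem_range_map_app_iff M.injective_subtype]
  constructor
  · intro h x hx
    obtain ⟨a, d, hd, h1⟩ := h ⟨x, hx⟩
    rw [hσ] at h1
    have h2 := (mk_eq_mk_iff_of_isTorsionFree _ _ _ _ _).mp h1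
    rw [OneMemClass.coe_one, one_smul] at h2
    refine ⟨d, hd, ?_⟩
    rw [h2]
    exact a.2
  · intro h x
    obtain ⟨d, hd, h1⟩ := h x.1 x.2
    refine ⟨⟨d • w, h1⟩, d, hd, ?_⟩
    rw [hσ]
    exact (mk_eq_mk_iff_of_isTorsionFree _ _ _ _ _).mpr (by rw [OneMemClass.coe_one, one_smul]; rfl)

end ConstantSheaf

end InvolutionSurface

/-! ### Subsheaves of a sheaf of modules and their comparison -/

namespace InvolutionSurface

section SheafOfModules

open Opposite TopologicalSpace

variable {X : Scheme.{u}} {F G H : X.Modules}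

theorem app_res (φ : F ⟶ G) {U V : X.Opens} (i : V ⟶ U) (σ : Γ(F, U)) :
    φ.app V (F.presheaf.map i.op σ) = G.presheaf.map i.op (φ.app U σ) :=
  congr($(φ.mapPresheaf.naturality i.op) σ)

theorem app_injective_of_locally (φ : F ⟶ G) {W : X.Opens}
    (h : ∀ x ∈ W, ∃ V ≤ W, x ∈ V ∧ Function.Injective (φ.app V)) :
    Function.Injective (φ.app W) := by
  intro σ τ hστ
  choose V hVW hxV hV using fun x : W ↦ h x.1 x.2
  refine TopCat.Sheaf.eq_of_locally_eq' ⟨_, F.isSheaf⟩ V W (fun x ↦ homOfLE (hVW x))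
    (fun x hx ↦ Opens.mem_iSup.mpr ⟨⟨x, hx⟩, hxV ⟨x, hx⟩⟩) σ τ fun x ↦ hV x ?_
  refine (app_res φ _ σ).trans (Eq.trans ?_ (app_res φ _ τ).symm)
  rw [hστ]

/-- Local preimages are unique by injectivity, so they agree on overlaps and glue. -/
theorem mem_range_app_of_locally (φ : F ⟶ G) (hφ : ∀ V, Function.Injective (φ.app V))
    {W : X.Opens} (σ : Γ(G, W)) (h : ∀ x ∈ W, ∃ V, ∃ hV : V ≤ W, x ∈ V ∧
      G.presheaf.map (homOfLE hV).op σ ∈ Set.range (φ.app V)) :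
    σ ∈ Set.range (φ.app W) := by
  choose V hVW hxV τ hτ using fun x : W ↦ h x.1 x.2
  have hcov : W ≤ iSup V := fun x hx ↦ Opens.mem_iSup.mpr ⟨⟨x, hx⟩, hxV ⟨x, hx⟩⟩
  obtain ⟨ρ, hρ, -⟩ := TopCat.Sheaf.existsUnique_gluing' ⟨_, F.isSheaf⟩ V W
    (fun x ↦ homOfLE (hVW x)) hcov τ fun x y ↦ hφ _ (by
      refine (app_res φ _ (τ x)).trans (Eq.trans ?_ (app_res φ _ (τ y)).symm)
      rw [hτ, hτ, ← G.presheaf.map_comp_apply, ← G.presheaf.map_comp_apply]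
      rfl)
  refine ⟨ρ, TopCat.Sheaf.eq_of_locally_eq' ⟨_, G.isSheaf⟩ V W (fun x ↦ homOfLE (hVW x)) hcov
    _ _ fun x ↦ ?_⟩
  refine (app_res φ _ ρ).symm.trans (Eq.trans ?_ (hτ x))
  exact congrArg (φ.app (V x)) (hρ x)

/-- A morphism of sheaves of modules from its values on sections. -/
theorem exists_hom_of_app (f : ∀ U : X.Opens, Γ(F, U) → Γ(G, U))
    (φ : G ⟶ H) (hφ : ∀ V, Function.Injective (φ.app V)) (ψ : F ⟶ H)
    (hf : ∀ U σ, φ.app U (f U σ) = ψ.app U σ) : ∃ e : F ⟶ G, e ≫ φ = ψ := by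
  -- Additivity, linearity and naturality of `f` are all forced, since they hold after composing
  -- with the injective `φ`.
  have f0 (U) : f U 0 = 0 := hφ _ (by rw [hf, map_zero, map_zero])
  have fadd (U) (x y : Γ(F, U)) : f U (x + y) = f U x + f U y :=
    hφ _ (by rw [hf, map_add, map_add, hf, hf])
  have fsmul (U) (a : Γ(X, U)) (x : Γ(F, U)) : f U (a • x) = a • f U x :=
    hφ _ (by rw [hf, Scheme.Modules.Hom.app_smul, Scheme.Modules.Hom.app_smul, hf])
  let α : F.presheaf ⟶ G.presheaf :=
    { app U := AddCommGrpCat.ofHom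
        { toFun := f U.unop
          map_zero' := f0 U.unop
          map_add' := fadd U.unop }
      naturality U V i := by
        ext x
        refine hφ _ ?_
        refine (hf V.unop _).trans ?_
        refine (app_res ψ i.unop x).trans ?_
        refine Eq.trans ?_ (app_res φ i.unop (f U.unop x)).symm
        rw [hf] }
  let e : F ⟶ G := ⟨PresheafOfModules.homMk α fun U a x ↦ fsmul U.unop a x⟩
  refine ⟨e, Scheme.Modules.hom_ext _ _ fun U ↦ ?_⟩
  ext x
  exact hf U x

theorem exists_iso_of_range_eq (φ : G ⟶ H) (hφ : ∀ V, Function.Injective (φ.app V)) (ψ : F ⟶ H)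
    (hψ : ∀ V, Function.Injective (ψ.app V))
    (h : ∀ V, Set.range (ψ.app V) = Set.range (φ.app V)) : ∃ e : F ≅ G, e.hom ≫ φ = ψ := by
  have h1 (U : X.Opens) (σ : Γ(F, U)) : ∃ τ, φ.app U τ = ψ.app U σ :=
    (h U).le ⟨σ, rfl⟩
  have h2 (U : X.Opens) (σ : Γ(G, U)) : ∃ τ, ψ.app U τ = φ.app U σ :=
    (h U).ge ⟨σ, rfl⟩
  choose f hf using h1
  choose g hg using h2
  obtain ⟨e, he⟩ := exists_hom_of_app f φ hφ ψ hf
  obtain ⟨d, hd⟩ := exists_hom_of_app g ψ hψ φ hg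
  have hc {A B : X.Modules} (φ : A ⟶ B) (hφ : ∀ V, Function.Injective (φ.app V)) (e : A ⟶ A)
      (he : e ≫ φ = φ) : e = 𝟙 A := by
    refine Scheme.Modules.hom_ext _ _ fun U ↦ ?_
    ext x
    exact hφ U congr(($he).app U x)
  exact ⟨⟨e, d, hc ψ hψ _ (by rw [Category.assoc, hd, he]), hc φ hφ _ (by
    rw [Category.assoc, he, hd])⟩, he⟩

end SheafOfModules

/-! ### Sections of restrictions and direct images -/

section Restriction

variable {X Y : Scheme.{u}} (f : X ⟶ Y)

theorem pushforward_map_app_injective {F G : X.Modules} (φ : F ⟶ G)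
    (h : ∀ U, Function.Injective (φ.app U)) (V : Y.Opens) :
    Function.Injective (((Scheme.Modules.pushforward f).map φ).app V) :=
  h (f ⁻¹ᵁ V)

variable [IsOpenImmersion f]

/-- Sections of a restriction over `V` are by definition sections over `f ''ᵁ V`; the transfer
lemmas of this section rest on this. -/
theorem restrict_map_app_injective {F G : Y.Modules} (φ : F ⟶ G)
    (h : ∀ U, Function.Injective (φ.app U)) (V : X.Opens) :
    Function.Injective (((Scheme.Modules.restrictFunctor f).map φ).app V) :=
  h (f ''ᵁ V)

theorem range_restrict_map_app_eq {F G H : Y.Modules} (φ : F ⟶ H) (ψ : G ⟶ H) (V : X.Opens)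
    (h : Set.range (φ.app (f ''ᵁ V)) = Set.range (ψ.app (f ''ᵁ V))) :
    Set.range (((Scheme.Modules.restrictFunctor f).map φ).app V) =
      Set.range (((Scheme.Modules.restrictFunctor f).map ψ).app V) :=
  h

theorem iso_comp_app_injective_iff {F G H : X.Modules} (e : F ≅ G) (φ : G ⟶ H) (V : X.Opens) :
    Function.Injective ((e.hom ≫ φ).app V) ↔ Function.Injective (φ.app V) :=
  Function.Injective.of_comp_iff' _ (ConcreteCategory.bijective_of_isIso (e.hom.app V))

theorem range_iso_comp_app {F G H : X.Modules} (e : F ≅ G) (φ : G ⟶ H) (V : X.Opens) :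
    Set.range ((e.hom ≫ φ).app V) = Set.range (φ.app V) :=
  (ConcreteCategory.bijective_of_isIso (e.hom.app V)).2.range_comp (φ.app V)

theorem app_image_injective_of_restrict_iso {F G H : Y.Modules} (φ : F ⟶ H) (ψ : G ⟶ H)
    (e : F.restrict f ≅ G.restrict f) (h : e.hom ≫ (Scheme.Modules.restrictFunctor f).map ψ =
      (Scheme.Modules.restrictFunctor f).map φ) (V : X.Opens)
    (hψ : Function.Injective (ψ.app (f ''ᵁ V))) : Function.Injective (φ.app (f ''ᵁ V)) := by
  change Function.Injective (((Scheme.Modules.restrictFunctor f).map φ).app V)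
  rw [← h, iso_comp_app_injective_iff]
  exact hψ

theorem range_app_image_eq_of_restrict_iso {F G H : Y.Modules} (φ : F ⟶ H) (ψ : G ⟶ H)
    (e : F.restrict f ≅ G.restrict f) (h : e.hom ≫ (Scheme.Modules.restrictFunctor f).map ψ =
      (Scheme.Modules.restrictFunctor f).map φ) (V : X.Opens) :
    Set.range (φ.app (f ''ᵁ V)) = Set.range (ψ.app (f ''ᵁ V)) := by
  change Set.range (((Scheme.Modules.restrictFunctor f).map φ).app V) = _
  rw [← h, range_iso_comp_app]
  rfl

theorem comp_unit_app_injective {G H : Y.Modules} (ψ : G ⟶ H) (V : Y.Opens)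
    (h : Function.Injective (ψ.app V)) (h' : Function.Injective
      (H.presheaf.map (homOfLE (f.image_preimage_le V)).op)) :
    Function.Injective
      ((ψ ≫ (Scheme.Modules.restrictAdjunction f).unit.app H).app V) :=
  h'.comp h

/-- The unit of the adjunction over `V` is the restriction map from `V` to `f ''ᵁ (f ⁻¹ᵁ V)`, which
makes `h` and `h'` the two halves of the claim. -/
theorem range_comp_unit_app_eq_range_pushforward {F : X.Modules} {G H : Y.Modules} (ψ : G ⟶ H)
    (φ : F ⟶ H.restrict f) (V : Y.Opens)
    (h : Set.range (fun σ ↦ H.presheaf.map (homOfLE (f.image_preimage_le V)).op (ψ.app V σ)) =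
      Set.range (ψ.app (f ''ᵁ (f ⁻¹ᵁ V))))
    (h' : Set.range (φ.app (f ⁻¹ᵁ V)) =
      Set.range (((Scheme.Modules.restrictFunctor f).map ψ).app (f ⁻¹ᵁ V))) :
    Set.range ((ψ ≫ (Scheme.Modules.restrictAdjunction f).unit.app H).app V) =
      Set.range (((Scheme.Modules.pushforward f).map φ).app V) :=
  h.trans h'.symm

end Restriction

end InvolutionSurface

/-! ### Gluing the local models -/

namespace InvolutionSurface

open Opposite TopologicalSpace

theorem range_app_eq_of_locally {X : Scheme.{u}} {F G H : X.Modules} (φ : F ⟶ H) (ψ : G ⟶ H)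
    (hφ : ∀ V, Function.Injective (φ.app V)) (hψ : ∀ V, Function.Injective (ψ.app V))
    {W : X.Opens} (h : ∀ x ∈ W, ∃ V ≤ W, x ∈ V ∧ Set.range (φ.app V) = Set.range (ψ.app V)) :
    Set.range (φ.app W) = Set.range (ψ.app W) := by
  apply Set.Subset.antisymm
  · rintro _ ⟨τ, rfl⟩
    refine mem_range_app_of_locally ψ hψ _ fun x hx ↦ ?_
    obtain ⟨V, hV, hxV, h⟩ := h x hx
    refine ⟨V, hV, hxV, ?_⟩
    rw [← h]
    exact ⟨_, app_res φ (homOfLE hV) τ⟩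
  · rintro _ ⟨τ, rfl⟩
    refine mem_range_app_of_locally φ hφ _ fun x hx ↦ ?_
    obtain ⟨V, hV, hxV, h⟩ := h x hx
    refine ⟨V, hV, hxV, ?_⟩
    rw [h]
    exact ⟨_, app_res ψ (homOfLE hV) τ⟩

variable {k : Type u} [Field k] {m : ℕ}

theorem exists_smul_eq_forms (d : BaseRing k m) (hd : d ≠ 0) (w : Forms k m) :
    ∃ w', d • w' = w := by
  have h0 : algebraMap (BaseRing k m) (FunField k m) d ≠ 0 :=
    (FaithfulSMul.algebraMap_eq_zero_iff _ _).not.mpr hd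
  refine ⟨(algebraMap (BaseRing k m) (FunField k m) d)⁻¹ • w, ?_⟩
  rw [← algebraMap_smul (FunField k m) d, smul_smul, mul_inv_cancel₀ h0, one_smul]

theorem isTorsionFree_forms : Module.IsTorsionFree (BaseRing k m) (Forms k m) :=
  Module.IsTorsionFree.trans_faithfulSMul (BaseRing k m) (FunField k m) (Forms k m)

attribute [local instance] isTorsionFree_forms

theorem sheafIncl_app_injective (M : Submodule (BaseRing k m) (Forms k m)) (U : (base k m).Opens) :
    Function.Injective ((sheafIncl k m M).app U) :=
  map_app_injective M.injective_subtype

theorem exists_germAt_forms_eq_const {U : (base k m).Opens} (hU : ∃ x : PrimeSpectrum _, x ∈ U)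
    (σ : Γ(sheafOfForms k m, U)) : ∃ w : Forms k m, ∀ x : U, germAt σ x = LocalizedModule.mk w 1 :=
  exists_germAt_eq_const exists_smul_eq_forms hU σ

/-- A section of the sheaf of forms is one constant form `w`, so the two subsheaves are compared by
local membership of `w`. -/
theorem range_sheafIncl_app_eq {M M' : Submodule (BaseRing k m) (Forms k m)}
    {U : (base k m).Opens} (h : ∀ x : PrimeSpectrum (BaseRing k m), x ∈ U → ∀ w : Forms k m,
      (∃ d ∉ x.asIdeal, d • w ∈ M) ↔ ∃ d ∉ x.asIdeal, d • w ∈ M') :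
    Set.range ((sheafIncl k m M).app U) = Set.range ((sheafIncl k m M').app U) := by
  ext σ
  by_cases hU : ∃ x : PrimeSpectrum (BaseRing k m), x ∈ U
  · obtain ⟨w, hw⟩ := exists_germAt_forms_eq_const hU σ
    refine (mem_range_map_subtype_app_iff M σ w hw).trans
      (Iff.trans ?_ (mem_range_map_subtype_app_iff M' σ w hw).symm)
    exact forall₂_congr fun x hx ↦ h x hx w
  -- Over the empty set there need be no constant to pick, but the stalkwise conditions are vacuous.
  · push Not at hU
    refine (mem_range_map_app_iff M.injective_subtype σ).trans
      (Iff.trans ?_ (mem_range_map_app_iff M'.injective_subtype σ).symm)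
    exact ⟨fun _ x ↦ (hU x.1 x.2).elim, fun _ x ↦ (hU x.1 x.2).elim⟩

theorem locally_mem_interModule_iff (hk : (2 : k) ≠ 0) {i : Fin 3}
    {x : PrimeSpectrum (BaseRing k m)} (hx : chartFun k m i ∉ x.asIdeal) (w : Forms k m) :
    (∃ d ∉ x.asIdeal, d • w ∈ interModule k m) ↔
      ∃ d ∉ x.asIdeal, d • w ∈ localModelBase k m i := by
  constructor
  · rintro ⟨d, hd, h⟩
    exact ⟨d, hd, iInf_le (localModelBase k m) i h⟩
  · rintro ⟨d, hd, h⟩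
    obtain ⟨n, hn⟩ := exists_pow_smul_mem_span_of_mem_localModelBase hk h
    rw [← interModule_eq_span hk, smul_smul] at hn
    exact ⟨_, x.asIdeal.primeCompl.mul_mem (x.asIdeal.primeCompl.pow_mem hx n) hd, hn⟩

/-- The inclusion of a chart in the union of the charts. -/
abbrev chartIncl (k : Type u) [Field k] (m : ℕ) (i : Fin 3) :
    (chart k m i).toScheme ⟶ (locus k m).toScheme :=
  (base k m).homOfLE (chart_le_locus k m i)

theorem chartIncl_apply (i : Fin 3) (z : (chart k m i).toScheme) :
    (chartIncl k m i z).1 = z.1 :=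
  congr($((base k m).homOfLE_ι (chart_le_locus k m i)) z)

theorem chartFun_notMem_of_mem {i : Fin 3} {V : (chart k m i).toScheme.Opens}
    {x : PrimeSpectrum (BaseRing k m)} (hx : x ∈ (locus k m).ι ''ᵁ (chartIncl k m i ''ᵁ V)) :
    chartFun k m i ∉ x.asIdeal := by
  obtain ⟨y, ⟨z, hz, rfl⟩, rfl⟩ := hx
  have h : ((locus k m).ι (chartIncl k m i z) : PrimeSpectrum (BaseRing k m)) = z.1 :=
    chartIncl_apply i z
  have h2 : chartFun k m i ∉ ((show PrimeSpectrum (BaseRing k m) from z.1)).asIdeal := z.2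
  exact fun h3 ↦ h2 (h ▸ h3)

theorem range_sheafIncl_chart_eq (hk : (2 : k) ≠ 0) (i : Fin 3)
    (V : (chart k m i).toScheme.Opens) :
    Set.range ((sheafIncl k m (interModule k m)).app ((locus k m).ι ''ᵁ (chartIncl k m i ''ᵁ V))) =
      Set.range ((sheafIncl k m (localModelBase k m i)).app
        ((locus k m).ι ''ᵁ (chartIncl k m i ''ᵁ V))) :=
  range_sheafIncl_app_eq fun _ hx w ↦ locally_mem_interModule_iff hk (chartFun_notMem_of_mem hx) w

/-- The restriction of the inclusion of a sheaf of forms to the union of the charts. -/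
abbrev locusIncl (M : Submodule (BaseRing k m) (Forms k m)) :
    (sheafOf k m M).restrict (locus k m).ι ⟶ (sheafOfForms k m).restrict (locus k m).ι :=
  (Scheme.Modules.restrictFunctor (locus k m).ι).map (sheafIncl k m M)

theorem locusIncl_app_injective (M : Submodule (BaseRing k m) (Forms k m))
    (V : (locus k m).toScheme.Opens) : Function.Injective ((locusIncl M).app V) :=
  restrict_map_app_injective _ _ (sheafIncl_app_injective M) V

theorem range_locusIncl_app_image_eq (hk : (2 : k) ≠ 0) (i : Fin 3)
    (V : (chart k m i).toScheme.Opens) :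
    Set.range ((locusIncl (interModule k m)).app (chartIncl k m i ''ᵁ V)) =
      Set.range ((locusIncl (localModelBase k m i)).app (chartIncl k m i ''ᵁ V)) :=
  range_restrict_map_app_eq _ _ _ _ (range_sheafIncl_chart_eq hk i V)

/-- The glued sheaf is the restriction to `locus` of the sheaf attached to `interModule`; on a chart
it has the same sections, inside the forms, as the local model. -/
theorem exists_gluing (hk : (2 : k) ≠ 0) :
    ∃ F : (locus k m).toScheme.Modules, Nonempty (Gluing k m F) := by
  have h (i : Fin 3) := exists_iso_of_range_eq _
    (restrict_map_app_injective (chartIncl k m i) _ (locusIncl_app_injective (localModelBase k m i)))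
    _ (restrict_map_app_injective (chartIncl k m i) _ (locusIncl_app_injective (interModule k m)))
    fun V ↦ range_restrict_map_app_eq _ _ _ _ (range_locusIncl_app_image_eq hk i V)
  exact ⟨_, ⟨locusIncl (interModule k m), fun i ↦ (h i).choose, fun i ↦ (h i).choose_spec⟩⟩

theorem exists_chart_nhds {W : (locus k m).toScheme.Opens} {x} (hx : x ∈ W) :
    ∃ i, ∃ V : (chart k m i).toScheme.Opens, chartIncl k m i ''ᵁ V ≤ W ∧
      x ∈ chartIncl k m i ''ᵁ V := by
  obtain ⟨i, hi⟩ := Opens.mem_iSup.mp x.2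
  have h : chartIncl k m i ⟨x.1, hi⟩ = x := Subtype.ext (chartIncl_apply i ⟨x.1, hi⟩)
  refine ⟨i, chartIncl k m i ⁻¹ᵁ W, Scheme.Hom.image_preimage_le _ _, ⟨⟨x.1, hi⟩, ?_, h⟩⟩
  change chartIncl k m i ⟨x.1, hi⟩ ∈ W
  rwa [h]

section Uniqueness

variable {F : (locus k m).toScheme.Modules} (g : Gluing k m F)
include g

theorem incl_app_injective (W : (locus k m).toScheme.Opens) :
    Function.Injective (g.incl.app W) := by
  refine app_injective_of_locally _ fun x hx ↦ ?_
  obtain ⟨i, V, hV, hxV⟩ := exists_chart_nhds hx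
  refine ⟨_, hV, hxV, ?_⟩
  exact app_image_injective_of_restrict_iso _ _ _ (g.chartIso i) (g.compat i) V
    (locusIncl_app_injective _ _)

/-- The compatible chart isomorphisms determine the image of `F` in the sheaf of forms on each
chart, hence everywhere. Thus every gluing is the same subsheaf. -/
theorem range_incl_app (hk : (2 : k) ≠ 0) (W : (locus k m).toScheme.Opens) :
    Set.range (g.incl.app W) =
      Set.range ((locusIncl (interModule k m)).app W) := by
  refine range_app_eq_of_locally g.incl (locusIncl (interModule k m))
    (incl_app_injective g) (locusIncl_app_injective _) fun x hx ↦ ?_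
  obtain ⟨i, V, hV, hxV⟩ := exists_chart_nhds hx
  refine ⟨_, hV, hxV, ?_⟩
  exact (range_app_image_eq_of_restrict_iso _ _ _ (g.chartIso i) (g.compat i) V).trans
    (range_locusIncl_app_image_eq hk i V).symm

end Uniqueness

end InvolutionSurface

/-! ### The direct image -/

namespace InvolutionSurface

open Opposite TopologicalSpace

variable {k : Type u} [Field k] {m : ℕ}

attribute [local instance] isTorsionFree_forms

theorem mem_of_le_asIdeal {R : Type u} [CommRing R] {V : Opens (PrimeSpectrum R)}
    {x y : PrimeSpectrum R} (hx : x ∈ V) (h : y.asIdeal ≤ x.asIdeal) : y ∈ V :=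
  ((PrimeSpectrum.le_iff_specializes y x).mp h).mem_open V.2 hx

theorem mem_locus_iff {x : PrimeSpectrum (BaseRing k m)} :
    x ∈ locus k m ↔ ∃ i, chartFun k m i ∉ x.asIdeal :=
  Opens.mem_iSup

theorem bot_mem {V : Opens (PrimeSpectrum (BaseRing k m))} {x : PrimeSpectrum (BaseRing k m)}
    (hx : x ∈ V) : (⊥ : PrimeSpectrum (BaseRing k m)) ∈ V :=
  mem_of_le_asIdeal hx bot_le

theorem bot_mem_locus : (⊥ : PrimeSpectrum (BaseRing k m)) ∈ locus k m :=
  mem_locus_iff.mpr ⟨0, chartFun_ne_zero 0⟩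

section Restriction

variable {V V' : (base k m).Opens} (i : V' ⟶ V)
  (hV : ∀ x : PrimeSpectrum (BaseRing k m), x ∈ V → x ∈ locus k m → x ∈ V')
include hV

/-- Sections are constant, and the generic point lies in `V'` as soon as `V` is nonempty. -/
theorem forms_res_injective :
    Function.Injective ((sheafOfForms k m).presheaf.map i.op) := by
  intro σ τ h
  refine germAt_ext fun x ↦ ?_
  obtain ⟨w, hw⟩ := exists_germAt_forms_eq_const ⟨x.1, x.2⟩ σ
  obtain ⟨w', hw'⟩ := exists_germAt_forms_eq_const ⟨x.1, x.2⟩ τ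
  have hb : (⊥ : PrimeSpectrum (BaseRing k m)) ∈ V' := hV _ (bot_mem x.2) bot_mem_locus
  let z : V' := ⟨(⊥ : PrimeSpectrum (BaseRing k m)), hb⟩
  have h1 : germAt σ (i z) = germAt τ (i z) := by
    rw [← germAt_res i, ← germAt_res i, h]
  rw [hw, hw', mk_eq_mk_iff_of_isTorsionFree] at h1
  have h2 : w = w' := by simpa using h1
  rw [hw, hw', h2]

/-- Hartogs for sections: a section over `V'` is a form `w` lying locally in the module there. At a
point of `V`, the primes below it that belong to a chart lie in `V'`, so
`exists_smul_mem_span_extGen` applies. -/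
theorem range_sheafIncl_comp_res (hk : (2 : k) ≠ 0) :
    Set.range (fun σ ↦ (sheafOfForms k m).presheaf.map i.op
      ((sheafIncl k m (interModule k m)).app V σ)) =
    Set.range ((sheafIncl k m (interModule k m)).app V') := by
  apply Set.Subset.antisymm
  · rintro _ ⟨σ, rfl⟩
    exact ⟨_, app_res (sheafIncl k m (interModule k m)) i σ⟩
  · intro ρ hρ
    by_cases hne : ∃ x : PrimeSpectrum (BaseRing k m), x ∈ V
    · have hne' : ∃ x : PrimeSpectrum (BaseRing k m), x ∈ V' :=
        ⟨⊥, hV _ (bot_mem hne.choose_spec) bot_mem_locus⟩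
      obtain ⟨w, hw⟩ := exists_germAt_forms_eq_const hne' ρ
      have h1 := (mem_range_map_subtype_app_iff (interModule k m) ρ w hw).mp hρ
      obtain ⟨σ, hσ⟩ := exists_germAt_eq (M := ModuleCat.of (BaseRing k m) (Forms k m)) (U := V)
        (fun x ↦ LocalizedModule.mk w 1)
        (fun x ↦ ⟨V, le_rfl, x.2, w, 1, fun y ↦ ⟨(show PrimeSpectrum (BaseRing k m) from y.1).2.one_notMem, rfl⟩⟩)
      have h2 : σ ∈ Set.range ((sheafIncl k m (interModule k m)).app V) := by
        refine (mem_range_map_subtype_app_iff (interModule k m) σ w hσ).mpr fun x hx ↦ ?_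
        rw [interModule_eq_span hk] at h1 ⊢
        refine exists_smul_mem_span_extGen hk w x.asIdeal fun q hq hqx ⟨j, hj⟩ ↦ ?_
        exact h1 ⟨q, hq⟩ (hV _ (mem_of_le_asIdeal hx hqx) (mem_locus_iff.mpr ⟨j, hj⟩))
      obtain ⟨τ, rfl⟩ := h2
      refine ⟨τ, germAt_ext fun x ↦ ?_⟩
      exact (hσ (i x)).trans (hw x).symm
    · exact ⟨0, germAt_ext fun x ↦ (hne ⟨x.1, i.le x.2⟩).elim⟩

end Restriction

/-- Both sides embed in the direct image of the restricted sheaf of forms, with the same sections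
over every open set. -/
theorem exists_iso_directImage (hk : (2 : k) ≠ 0) (F : (locus k m).toScheme.Modules)
    (g : Gluing k m F) :
    ∃ e : sheafOf k m (interModule k m) ≅ directImage k m F,
      e.hom ≫ (Scheme.Modules.pushforward (locus k m).ι).map g.incl =
        sheafIncl k m (interModule k m) ≫
          (Scheme.Modules.restrictAdjunction (locus k m).ι).unit.app (sheafOfForms k m) := by
  have hmem (V : (base k m).Opens) (x : PrimeSpectrum (BaseRing k m)) (hx : x ∈ V)
      (hx' : x ∈ locus k m) : x ∈ (locus k m).ι ''ᵁ ((locus k m).ι ⁻¹ᵁ V) :=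
    ⟨⟨x, hx'⟩, hx, rfl⟩
  exact exists_iso_of_range_eq _ (pushforward_map_app_injective _ _ (incl_app_injective g)) _
    (fun V ↦ comp_unit_app_injective _ _ V (sheafIncl_app_injective _ V)
      (forms_res_injective _ (hmem V)))
    fun V ↦ range_comp_unit_app_eq_range_pushforward _ _ _ V
      (range_sheafIncl_comp_res _ (hmem V) hk) (range_incl_app g hk _)

theorem nonempty_directImage_iso_free (hk : (2 : k) ≠ 0) (F : (locus k m).toScheme.Modules)
    (g : Gluing k m F) :
    Nonempty (directImage k m F ≅ SheafOfModules.free.{u} (ULift.{u} (Fin 9))) := by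
  obtain ⟨e, -⟩ := exists_iso_directImage hk F g
  let b := (Module.Basis.span (linearIndependent_extGen_base (m := m) hk)).reindex
    Equiv.ulift.{u}.symm
  let f : interModule k m ≃ₗ[BaseRing k m] (ULift.{u} (Fin 9) →₀ BaseRing k m) :=
    (LinearEquiv.ofEq _ _ (interModule_eq_span hk)).trans b.repr
  exact ⟨e.symm ≪≫ (tilde.functor (.of (BaseRing k m))).mapIso f.toModuleIso ≪≫
    tildeFinsupp (ULift.{u} (Fin 9))⟩

end InvolutionSurface

/-! ### Points of projective space given by homogeneous coordinates in a domain -/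

namespace InvolutionSurface

attribute [local instance] MvPolynomial.gradedAlgebra

section Points

variable {R : Type u} [CommRing R] {D D' : Type*} [CommRing D] [CommRing D']

/-- Evaluation of polynomials in `X₀, …, X₈` along the line spanned by a vector. -/
def lineEval (φ : R →+* D) (z : Fin 9 → D) : MvPolynomial (Fin 9) R →+* Polynomial D :=
  MvPolynomial.eval₂Hom (Polynomial.C.comp φ) fun i ↦ Polynomial.C (z i) * Polynomial.X

theorem eval₂_mul_of_mem_grading {d : ℕ} {G : MvPolynomial (Fin 9) R} (hG : G ∈ grading R d)
    (φ : R →+* D) (c : D) (z : Fin 9 → D) :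
    MvPolynomial.eval₂ φ (fun i ↦ z i * c) G = MvPolynomial.eval₂ φ z G * c ^ d := by
  rw [MvPolynomial.eval₂_eq', MvPolynomial.eval₂_eq', Finset.sum_mul]
  refine Finset.sum_congr rfl fun e he ↦ ?_
  have h : ∑ i, e i = d := by
    rw [← Finsupp.degree_eq_sum]
    rw [Finsupp.degree_eq_weight_one]
    exact (MvPolynomial.mem_homogeneousSubmodule d G).mp hG (MvPolynomial.mem_support_iff.mp he)
  simp_rw [mul_pow]
  rw [Finset.prod_mul_distrib, Finset.prod_pow_eq_pow_sum, h, mul_assoc]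

theorem lineEval_of_mem_grading {d : ℕ} {G : MvPolynomial (Fin 9) R} (hG : G ∈ grading R d)
    (φ : R →+* D) (z : Fin 9 → D) :
    lineEval φ z G = Polynomial.C (MvPolynomial.eval₂ φ z G) * Polynomial.X ^ d := by
  refine (eval₂_mul_of_mem_grading hG (Polynomial.C.comp φ) Polynomial.X
    (fun i ↦ Polynomial.C (z i))).trans ?_
  rw [MvPolynomial.hom_eval₂]

theorem lineEval_eq_zero_iff_of_mem_grading {d : ℕ} {G : MvPolynomial (Fin 9) R}
    (hG : G ∈ grading R d) (φ : R →+* D) (z : Fin 9 → D) :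
    lineEval φ z G = 0 ↔ MvPolynomial.eval₂ φ z G = 0 := by
  rw [lineEval_of_mem_grading hG, Polynomial.C_mul_X_pow_eq_monomial,
    Polynomial.monomial_eq_zero_iff]

/-- The extra variable separates degrees, so a polynomial lies in the kernel of `lineEval` exactly
when all its homogeneous components vanish at `z`. This makes the kernel a homogeneous ideal. -/
theorem coeff_lineEval (φ : R →+* D) (z : Fin 9 → D) (G : MvPolynomial (Fin 9) R) (d : ℕ) :
    (lineEval φ z G).coeff d =
      MvPolynomial.eval₂ φ z (MvPolynomial.homogeneousComponent d G) := by
  classical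
  conv_lhs => rw [← MvPolynomial.sum_homogeneousComponent G]
  rw [map_sum, Polynomial.finsetSum_coeff]
  have h (i : ℕ) : (lineEval φ z (MvPolynomial.homogeneousComponent i G)).coeff d =
      if d = i then MvPolynomial.eval₂ φ z (MvPolynomial.homogeneousComponent i G) else 0 := by
    rw [lineEval_of_mem_grading (MvPolynomial.homogeneousComponent_mem i G),
      Polynomial.coeff_C_mul_X_pow]
  simp_rw [h]
  rw [Finset.sum_ite_eq]
  split_ifs with hd
  · rfl
  · rw [MvPolynomial.homogeneousComponent_eq_zero, MvPolynomial.eval₂_zero]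
    simpa using hd

theorem lineEval_eq_zero_iff (φ : R →+* D) (z : Fin 9 → D) (G : MvPolynomial (Fin 9) R) :
    lineEval φ z G = 0 ↔
      ∀ d, MvPolynomial.eval₂ φ z (MvPolynomial.homogeneousComponent d G) = 0 := by
  rw [Polynomial.ext_iff]
  simp_rw [coeff_lineEval, Polynomial.coeff_zero]

theorem isHomogeneous_ker_lineEval (φ : R →+* D) (z : Fin 9 → D) :
    (RingHom.ker (lineEval φ z)).IsHomogeneous (grading R) := by
  intro d G hG
  change lineEval φ z (MvPolynomial.decomposition.decompose' G d : MvPolynomial (Fin 9) R) = 0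
  rw [MvPolynomial.decomposition.decompose'_apply, lineEval_eq_zero_iff_of_mem_grading
    (MvPolynomial.homogeneousComponent_mem d G)]
  exact (lineEval_eq_zero_iff φ z G).mp hG d

/-- The point of `ℙ⁸` over `Spec R` with given homogeneous coordinates in a domain. -/
def linePoint [IsDomain D] (φ : R →+* D) (z : Fin 9 → D) (hz : ∃ i, z i ≠ 0) :
    projSpace R :=
  show ProjectiveSpectrum (grading R) from
  { asHomogeneousIdeal := ⟨RingHom.ker (lineEval φ z), isHomogeneous_ker_lineEval φ z⟩
    isPrime := RingHom.ker_isPrime _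
    not_irrelevant_le h := by
      obtain ⟨i, hi⟩ := hz
      have hX : MvPolynomial.X i ∈ grading R 1 := MvPolynomial.isHomogeneous_X R i
      have h1 : lineEval φ z (MvPolynomial.X i) = 0 :=
        h (HomogeneousIdeal.mem_irrelevant_of_mem _ one_pos hX)
      rw [lineEval_eq_zero_iff_of_mem_grading hX, MvPolynomial.eval₂_X] at h1
      exact hi h1 }

theorem mem_linePoint_iff [IsDomain D] {φ : R →+* D} {z : Fin 9 → D} {hz : ∃ i, z i ≠ 0}
    {d : ℕ} {G : MvPolynomial (Fin 9) R} (hG : G ∈ grading R d) :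
    G ∈ (linePoint φ z hz).asHomogeneousIdeal ↔ MvPolynomial.eval₂ φ z G = 0 :=
  lineEval_eq_zero_iff_of_mem_grading hG φ z

theorem linePoint_specializes [IsDomain D] [IsDomain D'] {φ : R →+* D} {z : Fin 9 → D}
    {hz : ∃ i, z i ≠ 0} {φ' : R →+* D'} {z' : Fin 9 → D'} {hz' : ∃ i, z' i ≠ 0}
    (h : ∀ d, ∀ G ∈ grading R d, MvPolynomial.eval₂ φ z G = 0 → MvPolynomial.eval₂ φ' z' G = 0) :
    linePoint φ z hz ⤳ linePoint φ' z' hz' := by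
  rw [specializes_iff_mem_closure]
  refine (ProjectiveSpectrum.le_iff_mem_closure (𝒜 := grading R) (linePoint φ z hz)
    (linePoint φ' z' hz')).mp ?_
  intro G (hG : lineEval φ z G = 0)
  change lineEval φ' z' G = 0
  rw [lineEval_eq_zero_iff] at hG ⊢
  exact fun d ↦ h d _ (MvPolynomial.homogeneousComponent_mem d G) (hG d)

theorem mem_asHomogeneousIdeal_of_specializes {x y : projSpace R} (h : x ⤳ y)
    {G : MvPolynomial (Fin 9) R} (hG : G ∈ x.asHomogeneousIdeal) : G ∈ y.asHomogeneousIdeal := by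
  by_contra hy
  exact h.mem_open (Proj.basicOpen (grading R) G).2 hy hG

end Points

/-! ### Standard charts and the structure morphism -/

section Chart

variable {R : Type u} [CommRing R]

theorem X_mem_grading (i : Fin 9) : (MvPolynomial.X i : MvPolynomial (Fin 9) R) ∈ grading R 1 :=
  MvPolynomial.isHomogeneous_X R i

/-- The functions on the standard chart of `ℙ⁸` over `Spec R` where `Xᵢ` is invertible. -/
abbrev chartAway (R : Type u) [CommRing R] (i : Fin 9) : Type u :=
  HomogeneousLocalization.Away (grading R) (MvPolynomial.X i : MvPolynomial (Fin 9) R)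

/-- The structure morphism of the coordinate ring of a standard chart of `ℙ⁸`. -/
def chartAwayMap (R : Type u) [CommRing R] (i : Fin 9) : R →+* chartAway R i :=
  (HomogeneousLocalization.fromZeroRingHom (grading R) _).comp (algebraMap R (grading R 0))

/-- The inclusion of a standard chart of `ℙ⁸`. -/
abbrev chartAwayι (R : Type u) [CommRing R] (i : Fin 9) :
    Spec (.of (chartAway R i)) ⟶ projSpace R :=
  Proj.awayι (grading R) (MvPolynomial.X i) (X_mem_grading i) one_pos

theorem chartAwayι_projSpaceMap (i : Fin 9) : chartAwayι R i ≫ projSpaceMap R =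
    Spec.map (CommRingCat.ofHom (chartAwayMap R i)) := by
  rw [projSpaceMap, Proj.awayι_toSpecZero_assoc, ← Spec.map_comp]
  rfl

/-- The quotient of a form of degree `d` by the `d`-th power of `Xᵢ`. -/
def dehomog (i : Fin 9) {d : ℕ} {G : MvPolynomial (Fin 9) R} (hG : G ∈ grading R d) :
    chartAway R i :=
  HomogeneousLocalization.Away.mk (grading R) (X_mem_grading i) d G (by simpa using hG)

theorem mem_chartAwayι_iff (i : Fin 9) {d : ℕ} (hd : 0 < d) {G : MvPolynomial (Fin 9) R}
    (hG : G ∈ grading R d) (z : PrimeSpectrum (chartAway R i)) :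
    G ∈ (chartAwayι R i z).asHomogeneousIdeal ↔ dehomog i hG ∈ z.asIdeal := by
  have h := Proj.awayι_preimage_basicOpen (grading R) (X_mem_grading (R := R) i) one_pos hG hd
  have h1 : HomogeneousLocalization.Away.isLocalizationElem (X_mem_grading i) hG =
      dehomog i hG := by
    ext
    simp [dehomog, HomogeneousLocalization.Away.mk]
  have h2 : z ∈ chartAwayι R i ⁻¹ᵁ Proj.basicOpen (grading R) G ↔
      z ∈ PrimeSpectrum.basicOpen (dehomog i hG) := by
    rw [← h1, ← h]
    rfl
  exact not_iff_not.mp h2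

theorem C_mul_X_mem_grading (a : R) (i : Fin 9) :
    (MvPolynomial.C a * MvPolynomial.X i : MvPolynomial (Fin 9) R) ∈ grading R 1 :=
  MvPolynomial.isHomogeneous_C_mul_X a i

theorem dehomog_C_mul_X (a : R) (i : Fin 9) :
    dehomog i (C_mul_X_mem_grading a i) = chartAwayMap R i a := by
  ext
  refine Eq.trans (b := Localization.mk (MvPolynomial.C a) 1) ?_ rfl
  rw [dehomog, HomogeneousLocalization.Away.val_mk, Localization.mk_eq_mk_iff,
    Localization.r_iff_exists]
  exact ⟨1, by simp [mul_comm]⟩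

theorem exists_chartAwayι_eq {i : Fin 9} {x : projSpace R}
    (hx : MvPolynomial.X i ∉ x.asHomogeneousIdeal) : ∃ z, chartAwayι R i z = x := by
  have h : x ∈ (chartAwayι R i).opensRange := by
    rw [Proj.opensRange_awayι]
    exact hx
  exact h

/-- Multiplying the scalar `a` by `Xᵢ` gives a form of positive degree, as `mem_chartAwayι_iff`
requires; its dehomogenization is `a` again. -/
theorem mem_projSpaceMap_iff {i : Fin 9} {x : projSpace R}
    (hx : MvPolynomial.X i ∉ x.asHomogeneousIdeal) (a : R) :
    a ∈ (projSpaceMap R x).asIdeal ↔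
      MvPolynomial.C a * MvPolynomial.X i ∈ x.asHomogeneousIdeal := by
  obtain ⟨z, rfl⟩ := exists_chartAwayι_eq hx
  refine Iff.trans ?_ (mem_chartAwayι_iff i one_pos (C_mul_X_mem_grading a i) z).symm
  rw [dehomog_C_mul_X]
  have h : projSpaceMap R (chartAwayι R i z) =
      Spec.map (CommRingCat.ofHom (chartAwayMap R i)) z :=
    congr($(chartAwayι_projSpaceMap i) z)
  rw [h]
  rfl

theorem projSpaceMap_linePoint {D : Type*} [CommRing D] [IsDomain D] {φ : R →+* D}
    {z : Fin 9 → D} {i : Fin 9} (hi : z i ≠ 0) :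
    (projSpaceMap R (linePoint φ z ⟨i, hi⟩)).asIdeal =
      RingHom.ker φ := by
  ext a
  rw [mem_projSpaceMap_iff (i := i), mem_linePoint_iff (C_mul_X_mem_grading a i),
    MvPolynomial.eval₂_mul, MvPolynomial.eval₂_C, MvPolynomial.eval₂_X, mul_eq_zero_iff_right hi]
  · rfl
  · rwa [mem_linePoint_iff (X_mem_grading i), MvPolynomial.eval₂_X]

end Chart

end InvolutionSurface

/-! ### Specialization of relations and curves into the special fibers -/

namespace InvolutionSurface

section MapForms

variable {R S A B : Type*} [CommRing R] [CommRing S] [CommRing A] [CommRing B] [Algebra R A]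
  [Algebra S B]

theorem map_extForms (ψ : A →+* B) (φ : R →+* S)
    (h : ∀ a, ψ (algebraMap R A a) = algebraMap S B (φ a)) (r s t : R) (u v u' v' : A) :
    ∀ i, ψ (extForms r s t u v u' v' i) =
      extForms (φ r) (φ s) (φ t) (ψ u) (ψ v) (ψ u') (ψ v') i := by
  refine forall_fin_nine ?_ ?_ ?_ ?_ ?_ ?_ ?_ ?_ ?_ <;>
  simp only [extForms, Matrix.cons_val, Algebra.smul_def, map_mul, map_pow, map_add, map_sub, h]

end MapForms

variable {k : Type u} [Field k] {m : ℕ}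

/-- The forms `xᵢ` already have coefficients in the base ring. Descending the relation from the
function field makes it available for homomorphisms that kill `r`, `s` or `t`. -/
theorem aeval_extForms_eq_zero {G : MvPolynomial (Fin 9) (BaseRing k m)}
    (h : MvPolynomial.aeval (extGen k m) G = 0) :
    MvPolynomial.aeval (extForms (r k m) (s k m) (t k m)
      (.X 0 : MvPolynomial (Fin 4) (BaseRing k m)) (.X 1) (.X 2) (.X 3)) G = 0 := by
  have hinj : Function.Injective (MvPolynomial.map (σ := Fin 4)
      (algebraMap (BaseRing k m) (FunField k m))) :=
    MvPolynomial.map_injective _ (FaithfulSMul.algebraMap_injective _ _)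
  refine hinj ?_
  rw [map_zero, ← h, MvPolynomial.aeval_def, MvPolynomial.aeval_def, MvPolynomial.hom_eval₂]
  have h1 : (MvPolynomial.map (algebraMap (BaseRing k m) (FunField k m))).comp
      (algebraMap (BaseRing k m) (MvPolynomial (Fin 4) (BaseRing k m))) =
      algebraMap (BaseRing k m) (Forms k m) := by
    refine RingHom.ext fun a ↦ ?_
    simp [MvPolynomial.algebraMap_eq, IsScalarTower.algebraMap_eq (BaseRing k m) (FunField k m)
      (Forms k m)]
  rw [h1]
  congr 1
  funext i
  have h2 := map_extForms (MvPolynomial.map (σ := Fin 4)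
      (algebraMap (BaseRing k m) (FunField k m))) (RingHom.id (BaseRing k m))
      (fun a ↦ congr($h1 a)) (r k m) (s k m) (t k m) (.X 0) (.X 1) (.X 2) (.X 3) i
  simp only [MvPolynomial.map_X, RingHom.id_apply] at h2
  exact h2

/-- Relations between the sections `x₀, …, x₈` hold after every specialization. -/
theorem eval₂_extForms_eq_zero {G : MvPolynomial (Fin 9) (BaseRing k m)}
    (h : MvPolynomial.aeval (extGen k m) G = 0) {B : Type*} [CommRing B] (φ : BaseRing k m →+* B)
    (u v u' v' : B) :
    MvPolynomial.eval₂ φ (extForms (φ (r k m)) (φ (s k m)) (φ (t k m)) u v u' v') G = 0 := by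
  have h1 := congrArg (MvPolynomial.eval₂Hom φ ![u, v, u', v']) (aeval_extForms_eq_zero h)
  rw [map_zero, MvPolynomial.aeval_def, MvPolynomial.hom_eval₂] at h1
  have h2 : (MvPolynomial.eval₂Hom φ ![u, v, u', v']).comp
      (algebraMap (BaseRing k m) (MvPolynomial (Fin 4) (BaseRing k m))) = φ := by
    refine RingHom.ext fun a ↦ ?_
    simp [MvPolynomial.algebraMap_eq]
  rw [h2] at h1
  rw [← h1]
  congr 1
  funext i
  rw [map_extForms (MvPolynomial.eval₂Hom φ ![u, v, u', v']) φ
      (fun a ↦ congr($h2 a))]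
  simp

section Deformation

variable {E : Type*} [CommRing E]

/-- The coordinates of a point in the fibre of the closure over `r = s = t = 0`. -/
def specialCoord (x η ζ : E) : Fin 9 → E :=
  ![-x ^ 2, -η ^ 2, 1, ζ, 2 * x * η, 2 * x, η, 0, 0]

/-- The coordinates of a curve through a special point, with parameter `e`. -/
def curveCoord (e x η ζ : E) : Fin 9 → E :=
  ![(e * ζ * (4 * x ^ 2 - 1)) ^ 2 - (x + e * ζ * (4 * x ^ 2 + 1)) ^ 2,
    η ^ 2 * (16 * e ^ 2 * ζ ^ 2 - 1), 1, ζ, 2 * η * (x + e * ζ * (4 * x ^ 2 + 1)),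
    2 * (x + e * ζ * (4 * x ^ 2 + 1)), η, 4 * e ^ 2 * η * ζ * (4 * x ^ 2 - 1) ^ 2,
    32 * e ^ 2 * η ^ 2 * (x + e * ζ * (4 * x ^ 2 + 1)) * ζ]

theorem curveCoord_zero (x η ζ : E) : curveCoord 0 x η ζ = specialCoord x η ζ := by
  funext i
  revert i
  refine forall_fin_nine ?_ ?_ ?_ ?_ ?_ ?_ ?_ ?_ ?_ <;>
  simp [curveCoord, specialCoord] <;> ring

/-- With these values `uv' - vu' = 4x² + 1 + 16eζx`, `uv' + vu' = 4x² - 1` and `uu' + vv' = 4eζ(4x²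
- 1)`. The base coordinates are tuned so that the value of `x₂` divides all the others, with
quotients `ζ` for `x₃` and `η` for `x₆`. -/
theorem extForms_curve (e x η ζ : E) (i : Fin 9) :
    extForms (2 * e * η * (4 * x ^ 2 + 1 + 16 * e * ζ * x)) (2 * e * (4 * x ^ 2 - 1)) (4 * e * η)
      (2 * x) (-1) (1 + 8 * e * ζ * x) (2 * x + 4 * e * ζ) i =
    curveCoord e x η ζ i *
      (64 * e ^ 4 * η ^ 2 * (4 * x ^ 2 - 1) ^ 2 * (4 * x ^ 2 + 1 + 16 * e * ζ * x) ^ 2) := by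
  revert i
  refine forall_fin_nine ?_ ?_ ?_ ?_ ?_ ?_ ?_ ?_ ?_ <;>
  simp only [curveCoord, extForms, Matrix.cons_val, smul_eq_mul] <;> ring

/-- The homomorphism that moves the first three coordinates of the base. -/
def moveBase (φ : BaseRing k m →+* E) (a b c : E) : BaseRing k m →+* E :=
  MvPolynomial.eval₂Hom (φ.comp MvPolynomial.C) fun j ↦
    if j = 0 then a else if j = 1 then b else if j = 2 then c else φ (MvPolynomial.X j)

theorem fin_two_val : (2 : Fin (m + 3)).val = 2 := Nat.mod_eq_of_lt (by lia)

theorem fin_two_ne_zero : (2 : Fin (m + 3)) ≠ 0 := by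
  rw [Ne, Fin.ext_iff, fin_two_val]
  simp

theorem fin_two_ne_one : (2 : Fin (m + 3)) ≠ 1 := by
  rw [Ne, Fin.ext_iff, fin_two_val]
  simp

theorem moveBase_r (φ : BaseRing k m →+* E) (a b c : E) : moveBase φ a b c (r k m) = a := by
  simp [moveBase, r]

theorem moveBase_s (φ : BaseRing k m →+* E) (a b c : E) : moveBase φ a b c (s k m) = b := by
  simp [moveBase, s]

theorem moveBase_t (φ : BaseRing k m →+* E) (a b c : E) : moveBase φ a b c (t k m) = c := by
  simp [moveBase, t, fin_two_ne_zero, fin_two_ne_one]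

theorem comp_moveBase {E' : Type*} [CommRing E'] (ψ : E →+* E') (φ : BaseRing k m →+* E)
    (a b c : E) :
    ψ.comp (moveBase φ a b c) = moveBase (ψ.comp φ) (ψ a) (ψ b) (ψ c) := by
  apply MvPolynomial.ringHom_ext
  · intro x
    simp [moveBase]
  · intro j
    simp only [moveBase, RingHom.comp_apply, MvPolynomial.coe_eval₂Hom, MvPolynomial.eval₂_X]
    split_ifs <;> rfl

theorem moveBase_self (φ : BaseRing k m →+* E) :
    moveBase φ (φ (r k m)) (φ (s k m)) (φ (t k m)) = φ := by
  apply MvPolynomial.ringHom_ext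
  · intro x
    simp [moveBase]
  · intro j
    simp only [moveBase, MvPolynomial.coe_eval₂Hom, MvPolynomial.eval₂_X]
    split_ifs with h0 h1 h2
    · rw [h0, r]
    · rw [h1, s]
    · rw [h2, t]
    · rfl

/-- The relation holds along the curve over `E[e]`. By homogeneity the common factor comes out to
the power `d` and is cancelled in this domain, after which `e = 0` is allowed. The inequalities on
`x` and `η` keep the common factor nonzero. -/
theorem eval₂_specialCoord_eq_zero [IsDomain E] {φ : BaseRing k m →+* E} (hr : φ (r k m) = 0)
    (hs : φ (s k m) = 0) (ht : φ (t k m) = 0) {x η : E} (ζ : E) (h2 : (2 : E) ≠ 0) (hη : η ≠ 0)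
    (hx : 4 * x ^ 2 - 1 ≠ 0) (hx' : 4 * x ^ 2 + 1 ≠ 0) {d : ℕ}
    {G : MvPolynomial (Fin 9) (BaseRing k m)} (hG : G ∈ grading (BaseRing k m) d)
    (h : MvPolynomial.aeval (extGen k m) G = 0) :
    MvPolynomial.eval₂ φ (specialCoord x η ζ) G = 0 := by
  let c : E →+* Polynomial E := Polynomial.C
  let e : Polynomial E := Polynomial.X
  let ev : Polynomial E →+* E := Polynomial.evalRingHom 0
  have hev (a : E) : ev (c a) = a := Polynomial.eval_C
  have hee : ev e = 0 := Polynomial.eval_X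
  let φ' := moveBase (c.comp φ) (2 * e * c η * (4 * c x ^ 2 + 1 + 16 * e * c ζ * c x))
    (2 * e * (4 * c x ^ 2 - 1)) (4 * e * c η)
  have hφ : ev.comp φ' = φ := by
    have h1 : ev.comp (c.comp φ) = φ := by
      exact RingHom.ext fun a ↦ hev _
    rw [comp_moveBase, h1]
    simp only [map_mul, hee, mul_zero, zero_mul]
    conv_rhs => rw [← moveBase_self φ, hr, hs, ht]
  have h1 := eval₂_extForms_eq_zero h φ' (2 * c x) (-1) (1 + 8 * e * c ζ * c x)
    (2 * c x + 4 * e * c ζ)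
  rw [moveBase_r, moveBase_s, moveBase_t, funext (extForms_curve e (c x) (c η) (c ζ)),
    eval₂_mul_of_mem_grading hG] at h1
  have hne : 64 * e ^ 4 * c η ^ 2 * (4 * c x ^ 2 - 1) ^ 2 *
      (4 * c x ^ 2 + 1 + 16 * e * c ζ * c x) ^ 2 ≠ 0 := by
    have hc {a : E} (ha : a ≠ 0) : c a ≠ 0 := Polynomial.C_ne_zero.mpr ha
    have h64 : (64 : Polynomial E) ≠ 0 := by
      -- `64 = 2 ^ 6`.
      have := pow_ne_zero 6 (hc h2)
      rw [map_ofNat] at this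
      norm_num at this
      exact this
    have ha : (4 * c x ^ 2 - 1) ≠ 0 := fun h0 ↦ hx (by simpa [hev, map_ofNat ev] using congrArg ev h0)
    have hb : (4 * c x ^ 2 + 1 + 16 * e * c ζ * c x) ≠ 0 := fun h0 ↦ hx' (by
      simpa [hev, hee, map_ofNat ev] using congrArg ev h0)
    have he : e ≠ 0 := Polynomial.X_ne_zero
    have hη' := hc hη
    simp only [ne_eq, mul_eq_zero, pow_eq_zero_iff, OfNat.ofNat_ne_zero, not_false_eq_true]
    tauto
  have h3 := (mul_eq_zero_iff_right (pow_ne_zero d hne)).mp h1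
  have h4 := congrArg ev h3
  rw [map_zero, MvPolynomial.hom_eval₂, hφ] at h4
  rw [← h4, ← curveCoord_zero]
  congr 1
  funext i
  revert i
  refine forall_fin_nine ?_ ?_ ?_ ?_ ?_ ?_ ?_ ?_ ?_ <;>
  simp [curveCoord, hev, hee, map_ofNat ev]

end Deformation

end InvolutionSurface

/-! ### Dimension of the special fibers -/

namespace InvolutionSurface

attribute [local instance] MvPolynomial.gradedAlgebra

theorem le_topologicalKrullDim_of_specializes {T : Type*} [TopologicalSpace T] {n : ℕ}
    (p : Fin (n + 1) → T) (h : ∀ i : Fin n, p i.succ ⤳ p i.castSucc)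
    (h' : ∀ i : Fin n, ¬ p i.castSucc ⤳ p i.succ) : n ≤ topologicalKrullDim T := by
  let f (i : Fin (n + 1)) : TopologicalSpace.IrreducibleCloseds T :=
    ⟨closure {p i}, isIrreducible_singleton.closure, isClosed_closure⟩
  have hf : StrictMono f := Fin.strictMono_iff_lt_succ.mpr fun i ↦
    ⟨specializes_iff_closure_subset.mp (h i),
      fun h1 ↦ h' i (specializes_iff_closure_subset.mpr h1)⟩
  exact Order.LTSeries.length_le_krullDim (LTSeries.mk n f hf)

variable {k : Type u} [Field k] {m : ℕ}

/-- The inclusion of the closure of the involution surface bundle. -/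
abbrev closureι (k : Type u) [Field k] (m : ℕ) : closureScheme k m ⟶ ambient k m :=
  (Scheme.IdealSheafData.vanishingIdeal
    (TopologicalSpace.Closeds.closure (surfaceBundle k m))).subschemeι

theorem range_closureι : Set.range (closureι k m) = closure (surfaceBundle k m) := by
  refine (Scheme.IdealSheafData.range_subschemeι _).trans ?_
  rw [Scheme.IdealSheafData.coe_support_vanishingIdeal]
  rfl

instance : IsClosedImmersion (closureι k m) :=
  inferInstanceAs (IsClosedImmersion (Scheme.IdealSheafData.subschemeι _))

theorem le_topologicalKrullDim_fiber {X Y Z : Scheme.{u}} (ι : X ⟶ Z) [IsPreimmersion ι]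
    (f : X ⟶ Y) (y : Y) {n : ℕ} (p : Fin (n + 1) → Z) (hp : ∀ i, ∃ x, ι x = p i ∧ f x = y)
    (h : ∀ i : Fin n, p i.succ ⤳ p i.castSucc)
    (h' : ∀ i : Fin n, ¬ p i.castSucc ⤳ p i.succ) : n ≤ topologicalKrullDim (f.fiber y) := by
  choose x hx hy using hp
  let q (i : Fin (n + 1)) : f.fiber y := (f.fiberHomeo y).symm ⟨x i, hy i⟩
  have hq (i j) : q i ⤳ q j ↔ p i ⤳ p j := by
    rw [← hx, ← hx, ι.isEmbedding.isInducing.specializes_iff,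
      ← (f.fiberι y).isEmbedding.isInducing.specializes_iff,
      Scheme.Hom.fiberι_fiberHomeo_symm, Scheme.Hom.fiberι_fiberHomeo_symm]
  exact le_topologicalKrullDim_of_specializes q (fun i ↦ (hq _ _).mpr (h i))
    fun i ↦ (hq _ _).not.mpr (h' i)

theorem extGen_two_ne_zero (hk : (2 : k) ≠ 0) : extGen k m 2 ≠ 0 :=
  (linearIndependent_extGen_base hk).ne_zero 2

/-- The generic point of the involution surface bundle. -/
def genericPoint (hk : (2 : k) ≠ 0) : ambient k m :=
  linePoint (algebraMap (BaseRing k m) (Forms k m)) (extGen k m) ⟨2, extGen_two_ne_zero hk⟩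

theorem genericPoint_mem_surfaceBundle (hk : (2 : k) ≠ 0) :
    genericPoint hk ∈ surfaceBundle k m := by
  refine ⟨?_, fun d G hG h ↦ (mem_linePoint_iff hG).mpr h⟩
  refine mem_locus_iff.mpr ⟨0, ?_⟩
  rw [genericPoint, projSpaceMap_linePoint (extGen_two_ne_zero hk),
    (RingHom.injective_iff_ker_eq_bot _).mp]
  · exact chartFun_ne_zero 0
  · exact FaithfulSMul.algebraMap_injective (BaseRing k m) (Forms k m)

theorem linePoint_mem_closure_surfaceBundle (hk : (2 : k) ≠ 0) {D : Type*} [CommRing D]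
    [IsDomain D] {φ : BaseRing k m →+* D} {z : Fin 9 → D} {hz : ∃ i, z i ≠ 0}
    (h : ∀ d, ∀ G ∈ grading (BaseRing k m) d, MvPolynomial.aeval (extGen k m) G = 0 →
      MvPolynomial.eval₂ φ z G = 0) : linePoint φ z hz ∈ closure (surfaceBundle k m) :=
  (linePoint_specializes h : genericPoint hk ⤳ _).mem_closed isClosed_closure
    (subset_closure (genericPoint_mem_surfaceBundle hk))

section Special

variable {D : Type*} [CommRing D] [IsDomain D] (φ : BaseRing k m →+* D)

/-- A point of the ambient projective bundle over a point with `r = s = t = 0`. -/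
def specialPoint (a : Fin 3 → MvPolynomial (Fin 3) D) : ambient k m :=
  linePoint (MvPolynomial.C.comp φ) (specialCoord (a 0) (a 1) (a 2)) ⟨2, one_ne_zero⟩

theorem map_specialCoord {E E' : Type*} [CommRing E] [CommRing E'] (ψ : E →+* E') (x η ζ : E)
    (i : Fin 9) : ψ (specialCoord x η ζ i) = specialCoord (ψ x) (ψ η) (ψ ζ) i := by
  revert i
  refine forall_fin_nine ?_ ?_ ?_ ?_ ?_ ?_ ?_ ?_ ?_ <;>
  simp [specialCoord, map_ofNat ψ]

theorem specialPoint_specializes (a b : Fin 3 → MvPolynomial (Fin 3) D)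
    (h : ∀ i, MvPolynomial.aeval b (a i) = b i) : specialPoint φ a ⤳ specialPoint φ b := by
  refine linePoint_specializes fun d G _ hG ↦ ?_
  have h1 := congrArg (MvPolynomial.aeval b).toRingHom hG
  rw [map_zero, MvPolynomial.hom_eval₂] at h1
  rw [← h1]
  congr 1
  · refine RingHom.ext fun x ↦ ?_
    simp [MvPolynomial.algebraMap_eq]
  · funext i
    rw [map_specialCoord]
    simp only [AlgHom.toRingHom_eq_coe, RingHom.coe_coe, h]

theorem projSpaceMap_specialPoint (a : Fin 3 → MvPolynomial (Fin 3) D) :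
    (ambientMap k m (specialPoint φ a)).asIdeal = RingHom.ker φ := by
  have h : specialCoord (a 0) (a 1) (a 2) 2 ≠ 0 := one_ne_zero
  refine (projSpaceMap_linePoint h).trans ?_
  ext x
  simp [RingHom.mem_ker]

theorem X_mem_specialPoint_iff (a : Fin 3 → MvPolynomial (Fin 3) D) (i : Fin 9) :
    MvPolynomial.X i ∈ (specialPoint φ a).asHomogeneousIdeal ↔
      specialCoord (a 0) (a 1) (a 2) i = 0 := by
  rw [specialPoint, mem_linePoint_iff (X_mem_grading i), MvPolynomial.eval₂_X]

variable {φ}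

theorem two_ne_zero_of_ringHom (hk : (2 : k) ≠ 0) {E : Type*} [CommRing E] [Nontrivial E]
    (ψ : BaseRing k m →+* E) : (2 : E) ≠ 0 := by
  have h := (map_ne_zero (ψ.comp MvPolynomial.C)).mpr hk
  rwa [map_ofNat] at h

/-- With independent variables for `x`, `η`, `ζ` the inequalities are automatic: `4x² - 1` and `4x²
+ 1` have constant terms `-1` and `1`. All other special points specialize from this one, so they
need no inequalities. -/
theorem specialPoint_X_mem_closure (hk : (2 : k) ≠ 0) (hr : φ (r k m) = 0) (hs : φ (s k m) = 0)
    (ht : φ (t k m) = 0) : specialPoint φ MvPolynomial.X ∈ closure (surfaceBundle k m) := by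
  refine linePoint_mem_closure_surfaceBundle hk fun d G hG h ↦ ?_
  have hev (c : D) (hc : c ≠ 0) (f : MvPolynomial (Fin 3) D)
      (hf : MvPolynomial.constantCoeff f = c) : f ≠ 0 := by
    rintro rfl
    exact hc (by rw [← hf, map_zero])
  refine eval₂_specialCoord_eq_zero (by simp [hr]) (by simp [hs]) (by simp [ht]) _
    (two_ne_zero_of_ringHom hk (MvPolynomial.C.comp φ)) (MvPolynomial.X_ne_zero 1)
    (hev (-1) (by simp) _ (by simp)) (hev 1 (by simp) _ (by simp)) hG h

theorem specialPoint_mem_closure (hk : (2 : k) ≠ 0) (hr : φ (r k m) = 0) (hs : φ (s k m) = 0)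
    (ht : φ (t k m) = 0) (a : Fin 3 → MvPolynomial (Fin 3) D) :
    specialPoint φ a ∈ closure (surfaceBundle k m) :=
  (specialPoint_specializes φ MvPolynomial.X a fun i ↦ MvPolynomial.aeval_X a i).mem_closed
    isClosed_closure (specialPoint_X_mem_closure hk hr hs ht)

/-- The coordinates of a chain of special points. -/
def chainCoord (D : Type*) [CommRing D] : Fin 4 → Fin 3 → MvPolynomial (Fin 3) D :=
  ![![0, 0, 0], ![.X 0, 0, 0], ![.X 0, .X 1, 0], ![.X 0, .X 1, .X 2]]

theorem chain_specializes (i : Fin 3) : specialPoint φ (chainCoord D i.succ) ⤳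
    specialPoint φ (chainCoord D i.castSucc) := by
  refine specialPoint_specializes φ _ _ fun j ↦ ?_
  fin_cases i <;> fin_cases j <;> simp [chainCoord]

theorem not_chain_specializes (hk : (2 : k) ≠ 0) (i : Fin 3) :
    ¬ specialPoint φ (chainCoord D i.castSucc) ⤳ specialPoint φ (chainCoord D i.succ) := by
  have h2 := two_ne_zero_of_ringHom hk (MvPolynomial.C.comp φ : _ →+* MvPolynomial (Fin 3) D)
  intro h
  have h1 (j : Fin 9) := mem_asHomogeneousIdeal_of_specializes (G := .X j) h
  simp only [X_mem_specialPoint_iff] at h1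
  -- Coordinates `5`, `6`, `3` are `2x`, `η`, `ζ`; at each step of the chain one of them goes from
  -- zero to nonzero.
  have h5 := h1 5
  have h6 := h1 6
  have h3 := h1 3
  fin_cases i <;> simp [chainCoord, specialCoord, h2] at h3 h5 h6

end Special

theorem three_le_topologicalKrullDim_fiber_closureMap (hk : (2 : k) ≠ 0) (y : base k m)
    (hr : r k m ∈ y.asIdeal) (hs : s k m ∈ y.asIdeal) (ht : t k m ∈ y.asIdeal) :
    3 ≤ topologicalKrullDim ((closureMap k m).fiber y) := by
  have hy : (y.asIdeal).IsPrime := y.2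
  -- The kernel of this map is the ideal of `y`, so the special points built from it lie exactly
  -- over `y`.
  let φ : BaseRing k m →+* BaseRing k m ⧸ y.asIdeal := Ideal.Quotient.mk y.asIdeal
  have h0 {a} (ha : a ∈ y.asIdeal) : φ a = 0 := Ideal.Quotient.eq_zero_iff_mem.mpr ha
  refine le_topologicalKrullDim_fiber (closureι k m) (closureMap k m) y (n := 3)
    (fun i ↦ specialPoint φ (chainCoord _ i)) (fun i ↦ ?_) chain_specializes
    (not_chain_specializes hk)
  have h1 := specialPoint_mem_closure hk (h0 hr) (h0 hs) (h0 ht) (chainCoord _ i)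
  rw [← range_closureι] at h1
  obtain ⟨x, hx⟩ := h1
  refine ⟨x, hx, ?_⟩
  refine PrimeSpectrum.ext ?_
  have h2 : closureMap k m x = ambientMap k m (specialPoint φ (chainCoord _ i)) := by
    rw [← hx]
    rfl
  rw [h2]
  exact (projSpaceMap_specialPoint φ _).trans Ideal.mk_ker

end InvolutionSurface

/-! ### Failure of flatness -/

namespace InvolutionSurface

attribute [local instance] MvPolynomial.gradedAlgebra

theorem isReduced_subscheme_vanishingIdeal {X : Scheme.{u}} (Z : TopologicalSpace.Closeds X) :
    IsReduced (Scheme.IdealSheafData.vanishingIdeal Z).subscheme := by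
  let I := Scheme.IdealSheafData.vanishingIdeal Z
  have h (U : X.affineOpens) : IsReduced (Spec (.of (Γ(X, U.1) ⧸ I.ideal U))) := by
    have h1 : (I.ideal U).IsRadical := by
      rw [Scheme.IdealSheafData.vanishingIdeal_ideal]
      exact PrimeSpectrum.isRadical_vanishingIdeal _
    exact (affine_isReduced_iff _).mpr ((Ideal.isRadical_iff_quotient_reduced _).mp h1)
  exact (IsReduced.iff_of_openCover _ I.subschemeCover.openCover).mpr h

/-- The preimage of an affine open set under a closed immersion is affine. The last clause records
that the chart of `X` contains all points lying over the chart of `Y`. -/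
theorem exists_closed_affine_chart {X Y : Scheme.{u}} (ι : X ⟶ Y) [IsClosedImmersion ι]
    {A : CommRingCat.{u}} (j : Spec A ⟶ Y) [IsOpenImmersion j] :
    ∃ (B : CommRingCat.{u}) (ρ : A ⟶ B) (π : Spec B ⟶ X), IsOpenImmersion π ∧
      π ≫ ι = Spec.map ρ ≫ j ∧ ∀ x z, ι x = j z → ∃ b, π b = x := by
  have := isAffine_of_isAffineHom (Limits.pullback.snd ι j)
  let e := (Limits.pullback ι j).isoSpec
  obtain ⟨ρ, hρ⟩ := Spec.map_surjective (e.inv ≫ Limits.pullback.snd ι j)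
  refine ⟨_, ρ, e.inv ≫ Limits.pullback.fst ι j, inferInstance, ?_, fun x z h ↦ ?_⟩
  · rw [hρ, Category.assoc, Category.assoc, Limits.pullback.condition]
  · obtain ⟨p, hp, -⟩ := Scheme.Pullback.exists_preimage_pullback x z h
    refine ⟨e.hom p, ?_⟩
    rw [← Scheme.Hom.comp_apply, Iso.hom_inv_id_assoc, hp]

section Dehomog

variable {R : Type u} [CommRing R]

theorem exists_dehomog_val (i : Fin 9) : ∃ w : Localization.Away (.X i : MvPolynomial (Fin 9) R),
    algebraMap _ _ (.X i : MvPolynomial (Fin 9) R) * w = 1 ∧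
    ∀ (d : ℕ) (G : MvPolynomial (Fin 9) R) (hG : G ∈ grading R d),
      (dehomog i hG).val = algebraMap _ _ G * w ^ d := by
  refine ⟨IsLocalization.Away.invSelf _, IsLocalization.Away.mul_invSelf _, fun d G hG ↦ ?_⟩
  rw [dehomog, HomogeneousLocalization.Away.val_mk, Localization.mk_eq_mk',
    IsLocalization.mk'_eq_iff_eq_mul, map_pow, mul_assoc, ← mul_pow, mul_comm _ (algebraMap _ _ _),
    IsLocalization.Away.mul_invSelf, one_pow, mul_one]

theorem chartAwayMap_val (i : Fin 9) (a : R) : (chartAwayMap R i a).val =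
    algebraMap _ _ (MvPolynomial.C a : MvPolynomial (Fin 9) R) := rfl

end Dehomog

variable {k : Type u} [Field k] {m : ℕ}

/-- A quadratic relation between the sections `x₀, …, x₈`. -/
def quadRel (k : Type u) [Field k] (m : ℕ) : MvPolynomial (Fin 9) (BaseRing k m) :=
  .C (r k m ^ 2) * .X 2 ^ 2 + .C (s k m ^ 2 * t k m ^ 2) * .X 3 ^ 2 -
    .C (t k m ^ 2) * .X 5 ^ 2 - .C (s k m ^ 2) * .X 6 ^ 2

theorem quadRel_mem_grading : quadRel k m ∈ grading (BaseRing k m) 2 := by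
  have h (a : BaseRing k m) (i : Fin 9) : MvPolynomial.C a * MvPolynomial.X i ^ 2 ∈
      grading (BaseRing k m) 2 := MvPolynomial.isHomogeneous_C_mul_X_pow a i 2
  exact sub_mem (sub_mem (add_mem (h _ _) (h _ _)) (h _ _)) (h _ _)

/-- After removal of common factors this is `(uv' - vu')² + (uu' + vv')² = (uu' - vv')² + (uv' +
vu')²`. -/
theorem aeval_quadRel : MvPolynomial.aeval (extGen k m) (quadRel k m) = 0 := by
  simp only [quadRel, map_add, map_sub, map_mul, map_pow, MvPolynomial.aeval_X,
    MvPolynomial.aeval_C, extGen_eq k m, extForms, Matrix.cons_val, Algebra.smul_def]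
  ring

theorem quadRel_mem_of_mem_closure {x : ambient k m} (hx : x ∈ closure (surfaceBundle k m)) :
    quadRel k m ∈ x.asHomogeneousIdeal := by
  have h : IsClosed {x : ambient k m | quadRel k m ∈ x.asHomogeneousIdeal} := by
    rw [← isOpen_compl_iff]
    exact (Proj.basicOpen (grading (BaseRing k m)) (quadRel k m)).2
  exact closure_minimal (fun p hp ↦ hp.2 2 _ quadRel_mem_grading aeval_quadRel) h hx

/-- The terms are grouped as a linear relation among `r²`, `s²`, `t²` in which `r²` has coefficient
`1`. -/
theorem dehomog_quadRel : dehomog 2 (quadRel_mem_grading (k := k) (m := m)) =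
    chartAwayMap _ 2 (r k m ^ 2) +
      chartAwayMap _ 2 (s k m ^ 2) * (chartAwayMap _ 2 (t k m ^ 2) *
        dehomog 2 (X_mem_grading 3) ^ 2 - dehomog 2 (X_mem_grading 6) ^ 2) -
      chartAwayMap _ 2 (t k m ^ 2) * dehomog 2 (X_mem_grading 5) ^ 2 := by
  obtain ⟨w, hw, h⟩ := exists_dehomog_val (R := BaseRing k m) 2
  ext
  simp only [HomogeneousLocalization.val_add, HomogeneousLocalization.val_sub,
    HomogeneousLocalization.val_mul, HomogeneousLocalization.val_pow, h, chartAwayMap_val, quadRel]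
  let α := algebraMap (MvPolynomial (Fin 9) (BaseRing k m)) (Localization.Away
    (MvPolynomial.X 2 : MvPolynomial (Fin 9) (BaseRing k m)))
  simp only [map_add, map_sub, map_mul, map_pow]
  linear_combination (α (MvPolynomial.C (r k m))) ^ 2 * (α (MvPolynomial.X 2) * w + 1) * hw

theorem constantCoeff_r : MvPolynomial.constantCoeff (r k m) = 0 :=
  MvPolynomial.constantCoeff_X (R := k) _

theorem constantCoeff_s : MvPolynomial.constantCoeff (s k m) = 0 :=
  MvPolynomial.constantCoeff_X (R := k) _

theorem constantCoeff_t : MvPolynomial.constantCoeff (t k m) = 0 :=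
  MvPolynomial.constantCoeff_X (R := k) _

/-- Putting `s = t = 0` leaves `r² a = 0`, so `a` vanishes on `s = t = 0`, in particular at the
origin. -/
theorem constantCoeff_eq_zero_of_relation {a b c : BaseRing k m}
    (h : r k m ^ 2 * a + s k m ^ 2 * b + t k m ^ 2 * c = 0) :
    MvPolynomial.constantCoeff a = 0 := by
  let ψ := moveBase (RingHom.id (BaseRing k m)) (r k m) 0 0
  have h1 := congrArg ψ h
  simp only [map_add, map_mul, map_pow, ψ, moveBase_r, moveBase_s, moveBase_t, map_zero] at h1
  have h2 : ψ a = 0 := by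
    have hr := r_ne_zero (k := k) (m := m)
    simpa [hr] using h1
  have h3 : MvPolynomial.constantCoeff.comp ψ = MvPolynomial.constantCoeff := by
    rw [comp_moveBase, RingHom.comp_id, map_zero, constantCoeff_r]
    conv_rhs => rw [← moveBase_self MvPolynomial.constantCoeff, constantCoeff_r,
      constantCoeff_s, constantCoeff_t]
  rw [← h3, RingHom.comp_apply, h2, map_zero]

/-- By the equational criterion the relation with coefficients `1, b, c` in `B` is a combination of
relations over `R`. Its first entry `1` is thus a combination of first entries of relations over
`R`, which lie in `J`. -/
theorem one_mem_map_algebraMap_of_flat {R B : Type*} [CommRing R] [CommRing B] [Algebra R B] [Module.Flat R B]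
    {f₀ f₁ f₂ : R} {J : Ideal R} (hJ : ∀ a b c, f₀ * a + f₁ * b + f₂ * c = 0 → a ∈ J)
    {b c : B} (h : algebraMap R B f₀ + algebraMap R B f₁ * b + algebraMap R B f₂ * c = 0) :
    (1 : B) ∈ J.map (algebraMap R B) := by
  have hsum : ∑ i, ![f₀, f₁, f₂] i • ![1, b, c] i = 0 := by
    rw [Fin.sum_univ_three]
    simpa [Algebra.smul_def] using h
  obtain ⟨l, a, y, hy, ha⟩ := Module.Flat.isTrivialRelation_of_sum_smul_eq_zero
    (R := R) (M := B) (f := ![f₀, f₁, f₂]) (x := ![1, b, c]) hsum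
  have h1 : 1 = ∑ j, a 0 j • y j := hy 0
  rw [h1]
  refine Ideal.sum_mem _ fun j _ ↦ ?_
  rw [Algebra.smul_def]
  refine Ideal.mul_mem_right _ _ (Ideal.mem_map_of_mem _ (hJ _ (a 1 j) (a 2 j) ?_))
  have h2 := ha j
  rwa [Fin.sum_univ_three] at h2

theorem one_mem_map_of_flat {R B : Type*} [CommRing R] [CommRing B] (θ : R →+* B) (hθ : θ.Flat)
    {f₀ f₁ f₂ : R} {J : Ideal R} (hJ : ∀ a b c, f₀ * a + f₁ * b + f₂ * c = 0 → a ∈ J)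
    {b c : B} (h : θ f₀ + θ f₁ * b + θ f₂ * c = 0) : (1 : B) ∈ J.map θ := 
  @one_mem_map_algebraMap_of_flat _ _ _ _ θ.toAlgebra hθ _ _ _ _ hJ _ _ h

theorem not_flat_closureMap (hk : (2 : k) ≠ 0) : ¬ Flat (closureMap k m) := by
  intro hflat
  have hred : IsReduced (closureScheme k m) := isReduced_subscheme_vanishingIdeal _
  obtain ⟨B, ρ, π, hπ, hcomp, hsurj⟩ := exists_closed_affine_chart (closureι k m)
    (chartAwayι (BaseRing k m) 2)
  have hcomp' (b : Spec B) : closureι k m (π b) = chartAwayι _ 2 (Spec.map ρ b) :=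
    congr($hcomp b)
  let θ : CommRingCat.of (BaseRing k m) ⟶ B :=
    CommRingCat.ofHom (chartAwayMap (BaseRing k m) 2) ≫ ρ
  have hθ : π ≫ closureMap k m = Spec.map θ := by
    have h : π ≫ closureMap k m = (π ≫ closureι k m) ≫ ambientMap k m :=
      (Category.assoc _ _ _).symm
    rw [h, hcomp, Category.assoc, ambientMap, chartAwayι_projSpaceMap, ← Spec.map_comp]
  have hθflat : θ.hom.Flat := by
    rw [← Flat.SpecMap_iff, ← hθ]
    infer_instance
  have hB : _root_.IsReduced B := by
    have := isReduced_of_isOpenImmersion π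
    exact (affine_isReduced_iff B).mp this
  -- The quadratic relation vanishes at every point of the closure, and the chart is reduced, so it
  -- vanishes as a function.
  have hzero : ρ.hom (dehomog 2 (quadRel_mem_grading (k := k) (m := m))) = 0 := by
    refine IsReduced.eq_zero _ (nilpotent_iff_mem_prime.mpr fun P hP ↦ ?_)
    let b : Spec B := (⟨P, hP⟩ : PrimeSpectrum B)
    have h1 : quadRel k m ∈ (closureι k m (π b)).asHomogeneousIdeal :=
      quadRel_mem_of_mem_closure (range_closureι.le ⟨_, rfl⟩)
    rw [hcomp'] at h1
    exact (mem_chartAwayι_iff 2 two_pos quadRel_mem_grading _).mp h1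
  rw [dehomog_quadRel, map_sub, map_add, map_mul, map_mul] at hzero
  have hone := one_mem_map_of_flat θ.hom hθflat
    (J := RingHom.ker (MvPolynomial.constantCoeff : BaseRing k m →+* k))
    (fun _ _ _ ↦ constantCoeff_eq_zero_of_relation) (b := ρ.hom (chartAwayMap _ 2 (t k m ^ 2) *
        dehomog 2 (X_mem_grading 3) ^ 2 - dehomog 2 (X_mem_grading 6) ^ 2))
      (c := - ρ.hom (dehomog 2 (X_mem_grading 5) ^ 2)) (by
    refine Eq.trans ?_ hzero
    simp only [θ, CommRingCat.hom_comp, CommRingCat.hom_ofHom, RingHom.comp_apply]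
    ring)
  let φ : BaseRing k m →+* k := MvPolynomial.constantCoeff
  -- The special point with `x = η = ζ = 0` lies over the origin and has `X₂ = 1`, so it belongs to
  -- the chart. This contradicts `hone`, by which the maximal ideal of the origin generates the unit
  -- ideal there.
  let p := specialPoint φ 0
  have hp : p ∈ closure (surfaceBundle k m) := specialPoint_mem_closure hk
    constantCoeff_r constantCoeff_s constantCoeff_t 0
  rw [← range_closureι] at hp
  obtain ⟨x, hx⟩ := hp
  have hp2 : MvPolynomial.X 2 ∉ p.asHomogeneousIdeal := by
    rw [X_mem_specialPoint_iff]
    exact one_ne_zero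
  obtain ⟨z, hz⟩ := exists_chartAwayι_eq hp2
  obtain ⟨b, hb⟩ := hsurj x z (hx.trans hz.symm)
  have h1 : Spec.map θ b = ambientMap k m p := by
    rw [← hx, ← hb, ← hθ]
    rfl
  have h2 : (Spec.map θ b).asIdeal = RingHom.ker φ := by
    rw [h1]
    exact projSpaceMap_specialPoint φ 0
  have h3 : (RingHom.ker φ).map θ.hom ≤ b.asIdeal := by
    rw [Ideal.map_le_iff_le_comap, ← h2]
    exact le_rfl
  exact (PrimeSpectrum.isPrime b).one_notMem (h3 hone)

end InvolutionSurface

end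

theorem mainTheorem7 (k : Type u) [Field k] (hk : (2 : k) ≠ 0) (m : ℕ) :
    -- the intersection of the three local models is free on the explicit generators
    (InvolutionSurface.interModule k m =
        Submodule.span (InvolutionSurface.BaseRing k m)
          (Set.range (InvolutionSurface.extGen k m)) ∧
      LinearIndependent (InvolutionSurface.BaseRing k m) (InvolutionSurface.extGen k m)) ∧
    -- the explicit generators also form a basis of the local model on each chart
    (∀ i : Fin 3,
      InvolutionSurface.localModel k m i =
          Submodule.span (InvolutionSurface.chartRing k m i)
            (Set.range (InvolutionSurface.extGen k m)) ∧
        LinearIndependent (InvolutionSurface.chartRing k m i) (InvolutionSurface.extGen k m)) ∧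
    -- the local models glue, and the direct image of the resulting sheaf is the sheaf attached to
    -- the intersection of the local models, and is free of rank nine
    (∃ F : (InvolutionSurface.locus k m).toScheme.Modules,
      Nonempty (InvolutionSurface.Gluing k m F)) ∧
    (∀ (F : (InvolutionSurface.locus k m).toScheme.Modules) (g : InvolutionSurface.Gluing k m F),
      (∃ e : InvolutionSurface.sheafOf k m (InvolutionSurface.interModule k m) ≅
          InvolutionSurface.directImage k m F,
        e.hom ≫ (Scheme.Modules.pushforward (InvolutionSurface.locus k m).ι).map g.incl =
          InvolutionSurface.sheafIncl k m (InvolutionSurface.interModule k m) ≫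
            (Scheme.Modules.restrictAdjunction (InvolutionSurface.locus k m).ι).unit.app
              (InvolutionSurface.sheafOfForms k m)) ∧
      Nonempty (InvolutionSurface.directImage k m F ≅
        SheafOfModules.free.{u} (ULift.{u} (Fin 9)))) ∧
    -- the Zariski closure has fibers of dimension at least three, and is not flat
    (∀ y : InvolutionSurface.base k m,
      InvolutionSurface.r k m ∈ y.asIdeal → InvolutionSurface.s k m ∈ y.asIdeal →
      InvolutionSurface.t k m ∈ y.asIdeal →
        3 ≤ topologicalKrullDim ((InvolutionSurface.closureMap k m).fiber y)) ∧
    ¬ Flat (InvolutionSurface.closureMap k m) := by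
  refine ⟨⟨InvolutionSurface.interModule_eq_span hk,
    InvolutionSurface.linearIndependent_extGen_base hk⟩,
    fun i ↦ ⟨InvolutionSurface.localModel_eq_span hk i,
      InvolutionSurface.linearIndependent_extGen_chart hk i⟩,
    InvolutionSurface.exists_gluing hk,
    fun F g ↦ ⟨InvolutionSurface.exists_iso_directImage hk F g,
      InvolutionSurface.nonempty_directImage_iso_free hk F g⟩,
    InvolutionSurface.three_le_topologicalKrullDim_fiber_closureMap hk,
    InvolutionSurface.not_flat_closureMap hk⟩
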